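/- Let $m,n\ge 1$, $d=m+n$, $\mathbb T=\mathbb R/2\pi\mathbb Z$, and let $z=(x,y)\in\mathbb R^m\times\mathbb T^n$ with dual variable $(\xi,k)\in\mathbb R^m\times\mathbb Z^n$. Put $\langle z\rangle=(1+|z|^2)^{1/2}$. All functions $u$ below are functions $u:\mathbb R\to L^2(\mathbb R^m\times\mathbb T^n)$ of time $t$. *The space $Y^s$.* For a Hilbert space $H$ and $v:\mathbb R\to H$ let $\|v\|_{V^2}=\sup\big(\sum_{k=1}^K\|v(t_k)-v(t_{k-1})\|_H^2\big)^{1/2}$ over all finite partitions $-\infty<t_0<\dots<t_K\le\infty$, with $v(\infty):=0$, and let $\|u\|_{V^2_\Delta}=\|e^{-it\Delta_{x,y}}u(t)\|_{V^2}$. For $z\in\mathbb Z^d$ let $P_{C_z}$ be the Fourier multiplier with symbol the characteristic function of $C_z=z+(-\frac12,\frac12]^d$. For $s\ge0$ let $Y^s$ be the space of all $u$ with $$\|u\|_{Y^s}=\Big(\sum_{z\in\mathbb Z^d}\langle z\rangle^{2s}\|P_{C_z}u\|_{V^2_\Delta}^2\Big)^{1/2}<\infty .$$ *The $Z^s$-norm.*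 Dyadic numbers are $1,2,4,\dots$. Fix a smooth $\eta:\mathbb R\to[0,1]$ with $\eta=1$ on $[-1,1]$ and $\eta(t)=0$ for $|t|\ge2$. Let $P_{\le N}$ be the multiplier with symbol $\prod_i\eta(\xi_i/N)\prod_j\eta(k_j/N)$, $P_1=P_{\le1}$, $P_N=P_{\le N}-P_{\le N/2}$ for $N\ge2$; $P^t_{\le N}$, $P^t_N$ are the analogous multipliers in $t$, with symbol built from $\eta(\tau/N)$. For an $\mathbb R^m\times\mathbb Z^n$-frequency $\xi$ let $I_\xi u(t,z)=e^{iz\cdot\xi-it|\xi|^2}u(t,z-2t\xi)$. For $a\in\mathbb R$ let $\|f_N\|_{\ell^{a,2}_N}=(\sum_N N^{2a}|f_N|^2)^{1/2}$ and $$\|u\|_{B^a_{t,p,2}L^q_xL^2_y}=\big\|\,\|P_N^tu\|_{L^p_tL^q_xL^2_y}\big\|_{\ell^{a,2}_N}+\|P^t_1u\|_{L^p_tL^q_xL^2_y}.$$ Let $0<\sigma<\sigma_1<\frac14$, and let $m^*=(\frac14-\sigma)^{-1}$ if $m=1$, $m^*=(\frac12-\sigma)^{-1}$ if $m=2$, $m^*=2$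 if $m\ge3$. Let $T$ be any set of pairs $(p,a)$ with $m^*\le p\le\frac1{\sigma_1}$ and $\sigma\le a\le\frac1p-\sigma$ (for instance all such pairs, or those with $p\in\{m^*,\frac1{\sigma_1}\}$ and $a\in\{\sigma,\frac1p-\sigma\}$). Fix $c\in\{0,1,2,\dots\}$ and let $R\ll N$ mean $2^cR\le N$. With $q$ defined by $\frac2p+\frac mq=\frac m2$, put $$\|u\|_{Z^s}=\sup_{(p,a)\in T}\Big(\|P_Ru\|_{\ell^{s,2}_RL^p_tL^q_xL^2_y}+\|P_Ru\|_{\ell_R^{s-2a,2}B^a_{t,p,2}L^q_xL^2_y}+\Big\|\sup_{R\ll N}R^{-4\sigma}\big\|P_{\le8R}I_{Rk}P_Nu\big\|_{\ell^2_{k\in\mathbb Z^d}B^{2\sigma}_{t,p,2}L^q_xL^2_y}\Big\|_{\ell^{s,2}_N}\Big)\in[0,\infty],$$ where $R$ and $N$ are dyadic and a supremum over the empty set is $0$. **Statement.** For all $s\ge0$ and all $C_1,C_2\in(0,\infty)$, the set $$\mathcal K=\{u\in Y^s:\ \|u\|_{Y^s}\le 2C_1,\ \|u\|_{Z^s}\le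 2C_2\}$$ is a complete metric space with the metric $\rho(u,v)=\|u-v\|_{Y^0}$ (in particular, $\rho$ is finite on $\mathcal K$ and is a metric). -/

import Mathlib

open MeasureTheory Real Set Filter Topology FourierTransform
open scoped ENNReal

noncomputable section

namespace Waveguide

/-! ### The waveguide manifold and its square integrable functions -/

instance factTwoPiPos : Fact (0 < 2 * π) := ⟨Real.two_pi_pos⟩

/-- The torus `𝕋ⁿ`, where `𝕋 = ℝ / 2πℤ`; its volume is the product of the Lebesgue measures and
has total mass `(2π)ⁿ`. -/
abbrev Torus (n : ℕ) : Type := Fin n → AddCircle (2 * π)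

/-- `L²(𝕋ⁿ)`. -/
abbrev L2y (n : ℕ) : Type := Lp (α := Torus n) ℂ 2 (volume : Measure (Torus n))

/-- `L²(ℝᵐ × 𝕋ⁿ)`, realized as `L²(ℝᵐ; L²(𝕋ⁿ))` (Fubini), with `ℝᵐ` Euclidean. -/
abbrev L2xy (m n : ℕ) : Type :=
  Lp (α := EuclideanSpace ℝ (Fin m)) (L2y n) 2 (volume : Measure (EuclideanSpace ℝ (Fin m)))

open Classical in
/-- The class in `L²` of a square integrable function (and `0` for other functions). -/
def toL2 {X E : Type*} [MeasurableSpace X] [NormedAddCommGroup E] (μ : Measure X) (f : X → E) :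
    Lp E 2 μ :=
  if h : MemLp f 2 μ then h.toLp f else 0

variable {m n : ℕ}

/-! ### Fourier multipliers on `ℝᵐ × 𝕋ⁿ` -/

/-- The character `y ↦ e^{i k·y}` of `𝕋ⁿ`, `k ∈ ℤⁿ`. -/
def character (k : Fin n → ℤ) (y : Torus n) : ℂ := ∏ j, fourier (k j) (y j)

/-- The Fourier coefficient `(2π)⁻ⁿ ∫ g(y) e^{-i k·y} dy`. -/
def coeff (k : Fin n → ℤ) (g : L2y n) : ℂ :=
  (((2 * π) ^ n : ℝ) : ℂ)⁻¹ * ∫ y, (starRingEnd ℂ) (character k y) * g y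

/-- The Fourier multiplier on `L²(𝕋ⁿ)` with symbol `a`, that is
`g ↦ ∑ₖ a(k) ĝ(k) e^{i k·y}` with convergence in `L²(𝕋ⁿ)`. -/
def torusMultiplier (a : (Fin n → ℤ) → ℂ) (g : L2y n) : L2y n :=
  ∑' k, (a k * coeff k g) • toL2 volume (character k)

/-- The Fourier multiplier on `L²(ℝᵐ × 𝕋ⁿ)` with the bounded symbol `a(ξ, k)`, where
`(ξ, k) ∈ ℝᵐ × ℤⁿ` is dual to `(x, y)` through `e^{i(x·ξ + y·k)}`. The transform `𝓕` of Mathlib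
uses the phase `e^{-2πi x·ζ}`, so its variable `ζ` stands for the frequency `ξ = 2πζ`. -/
def multiplier (a : EuclideanSpace ℝ (Fin m) → (Fin n → ℤ) → ℂ) (f : L2xy m n) : L2xy m n :=
  𝓕⁻ (toL2 volume (fun ζ => torusMultiplier (a ((2 * π) • ζ)) ((𝓕 f : L2xy m n) ζ)) : L2xy m n)

/-- `|k|²` for `k ∈ ℤⁿ`. -/
def sqNorm (k : Fin n → ℤ) : ℝ := ∑ j, (k j : ℝ) ^ 2

/-- The Schrödinger group `e^{itΔ}` on `ℝᵐ × 𝕋ⁿ`. -/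
def schrodinger (t : ℝ) : L2xy m n → L2xy m n :=
  multiplier fun ξ k => Complex.exp (-(Complex.I * (t * (‖ξ‖ ^ 2 + sqNorm k) : ℝ)))

open Classical in
/-- The sharp frequency projector to the cube `z + (-1/2, 1/2]^d`, `z = (zx, zy) ∈ ℤᵐ × ℤⁿ`. -/
def cubeProj (z : (Fin m → ℤ) × (Fin n → ℤ)) : L2xy m n → L2xy m n :=
  multiplier fun ξ k =>
    if (∀ i, ξ i - z.1 i ∈ Ioc (-1 / 2 : ℝ) (1 / 2)) ∧
      (∀ j, (k j : ℝ) - z.2 j ∈ Ioc (-1 / 2 : ℝ) (1 / 2)) then 1 else 0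

/-! ### Littlewood-Paley projectors -/

/-- The admissible bump functions. -/
structure IsBump (η : ℝ → ℝ) : Prop where
  smooth : ContDiff ℝ (⊤ : ℕ∞) η
  mem_Icc : ∀ t, η t ∈ Icc (0 : ℝ) 1
  eq_one : ∀ t, |t| ≤ 1 → η t = 1
  eq_zero : ∀ t, 2 ≤ |t| → η t = 0

/-- The spatial projector `P_{≤ N}`, with symbol `∏ η(ξᵢ / N) ∏ η(kⱼ / N)`. -/
def lpLow (η : ℝ → ℝ) (N : ℝ) : L2xy m n → L2xy m n :=
  multiplier fun ξ k => (((∏ i, η (ξ i / N)) * ∏ j, η ((k j : ℝ) / N) : ℝ) : ℂ)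

/-- The spatial projector `P_N`, `N = 2 ^ j`: `P_1 = P_{≤ 1}`, and `P_N = P_{≤ N} - P_{≤ N/2}` for
`N ≥ 2`. -/
def lpProj (η : ℝ → ℝ) : ℕ → L2xy m n → L2xy m n
  | 0, f => lpLow η 1 f
  | j + 1, f => lpLow η (2 ^ (j + 1)) f - lpLow η (2 ^ j) f

/-- The convolution kernel on `ℝ` of the projector with symbol `τ ↦ η(τ / N)`. -/
def timeKernel (η : ℝ → ℝ) (N : ℝ) (t : ℝ) : ℂ :=
  ((2 * π : ℝ) : ℂ)⁻¹ * ∫ τ : ℝ, (η (τ / N) : ℂ) * Complex.exp (Complex.I * (t * τ : ℝ))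

/-- The temporal projector `P^t_{≤ N}` on bounded functions of time with values in `L²`. -/
def timeLow (η : ℝ → ℝ) (N : ℝ) (w : ℝ → L2xy m n) (t : ℝ) : L2xy m n :=
  ∫ r : ℝ, timeKernel η N (t - r) • w r

/-- The temporal projector `P^t_N`, `N = 2 ^ j`. -/
def timeProj (η : ℝ → ℝ) : ℕ → (ℝ → L2xy m n) → ℝ → L2xy m n
  | 0, w => timeLow η 1 w
  | j + 1, w => timeLow η (2 ^ (j + 1)) w - timeLow η (2 ^ j) w

/-! ### The spaces `Y^s` -/

/-- Functions on `ℝ` extended by `0` to the time `∞`. -/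
def extendTop {E : Type*} [Zero E] (v : ℝ → E) : WithTop ℝ → E
  | none => 0
  | some t => v t

/-- The norm of `V²`, with values in `[0, ∞]`: the supremum, over all finite partitions
`-∞ < t₀ < t₁ < ⋯ < t_K ≤ ∞`, of `(∑ ‖v(t_k) - v(t_{k-1})‖²)^{1/2}` with `v(∞) := 0`. -/
def vNorm {E : Type*} [NormedAddCommGroup E] (v : ℝ → E) : ℝ≥0∞ :=
  ⨆ (K : ℕ) (t : Fin (K + 1) → WithTop ℝ) (_ : StrictMono t),
    (∑ i : Fin K, ‖extendTop v (t i.succ) - extendTop v (t i.castSucc)‖ₑ ^ 2) ^ (1 / 2 : ℝ)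

/-- The norm of `V²_Δ`: `‖u‖ = ‖e^{-itΔ} u(t)‖_{V²}`. -/
def vDeltaNorm (u : ℝ → L2xy m n) : ℝ≥0∞ := vNorm fun t => schrodinger (-t) (u t)

/-- The norm of `Y^s`, with values in `[0, ∞]`:
`‖u‖² = ∑_{z ∈ ℤ^d} ⟨z⟩^{2s} ‖P_{C_z} u‖²_{V²_Δ}`, where `⟨z⟩² = 1 + |z|²`. -/
def yNorm (s : ℝ) (u : ℝ → L2xy m n) : ℝ≥0∞ :=
  (∑' z : (Fin m → ℤ) × (Fin n → ℤ),
    ENNReal.ofReal ((1 + (sqNorm z.1 + sqNorm z.2)) ^ s) *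
      vDeltaNorm (fun t => cubeProj z (u t)) ^ 2) ^ (1 / 2 : ℝ)

/-! ### The `Z^s` norm -/

/-- The norm of `L_t^p L_x^q L_y^2`. -/
def mixedNorm (p q : ℝ) (w : ℝ → L2xy m n) : ℝ≥0∞ :=
  eLpNorm (fun t => eLpNorm (w t) (ENNReal.ofReal q) volume) (ENNReal.ofReal p) volume

/-- The weighted `ℓ²` norm over dyadic numbers, `(∑_N N^{2s} a_N²)^{1/2}` with `N = 2 ^ j`. -/
def dyadicNorm (s : ℝ) (a : ℕ → ℝ≥0∞) : ℝ≥0∞ :=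
  (∑' j, (((2 : ℝ≥0∞) ^ j) ^ s * a j) ^ 2) ^ (1 / 2 : ℝ)

/-- The norm of the Besov space `B^a_{t,p,2} L_x^q L_y^2`. -/
def besovNorm (η : ℝ → ℝ) (a p q : ℝ) (w : ℝ → L2xy m n) : ℝ≥0∞ :=
  dyadicNorm a (fun j => mixedNorm p q (timeProj η j w)) + mixedNorm p q (timeProj η 0 w)

/-- On `L²(𝕋ⁿ)`, the map `g ↦ e^{i k·y} g(y - b k)`. -/
def torusGalilei (k : Fin n → ℤ) (b : ℝ) (g : L2y n) : L2y n :=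
  toL2 volume fun y => character k y * g (y - fun j => ((b * k j : ℝ) : AddCircle (2 * π)))

/-- The Galilean transformation `I_ξ u(t,z) = e^{i z·ξ - i t |ξ|²} u(t, z - 2tξ)`, for
`ξ = (ξx, ξy) ∈ ℝᵐ × ℤⁿ`. -/
def galilei (ξx : EuclideanSpace ℝ (Fin m)) (ξy : Fin n → ℤ) (u : ℝ → L2xy m n) (t : ℝ) :
    L2xy m n :=
  toL2 volume fun x =>
    Complex.exp (Complex.I * (inner ℝ x ξx - t * (‖ξx‖ ^ 2 + sqNorm ξy) : ℝ)) •
      torusGalilei ξy (2 * t) (u t (x - (2 * t) • ξx))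

/-- `I_{Rk}` for `R = 2 ^ i` and `k = (kx, ky) ∈ ℤᵐ × ℤⁿ`. -/
def galileiDyadic (i : ℕ) (k : (Fin m → ℤ) × (Fin n → ℤ)) (u : ℝ → L2xy m n) : ℝ → L2xy m n :=
  galilei (WithLp.toLp 2 fun l => (2 : ℝ) ^ i * (k.1 l : ℝ)) (fun l => 2 ^ i * k.2 l) u

/-- The exponent `q` for which `(p, q)` is an admissible Strichartz pair, that is
`2 / p + m / q = m / 2`. -/
def strichartzExponent (m : ℕ) (p : ℝ) : ℝ := (1 / 2 - 2 / (m * p))⁻¹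

/-- The smallest time exponent in the `Z^s` norm. -/
def mStar (m : ℕ) (σ : ℝ) : ℝ :=
  if m = 1 then (1 / 4 - σ)⁻¹ else if m = 2 then (1 / 2 - σ)⁻¹ else 2

/-- The pairs `(p, a)` with `m* ≤ p ≤ 1/σ₁` and `σ ≤ a ≤ 1/p - σ`. -/
def zParams (m : ℕ) (σ σ₁ : ℝ) : Set (ℝ × ℝ) :=
  {x | mStar m σ ≤ x.1 ∧ x.1 ≤ 1 / σ₁ ∧ σ ≤ x.2 ∧ x.2 ≤ 1 / x.1 - σ}

/-- The third term of the `Z^s` norm,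
`‖ max_{R ≪ N} R^{-4σ} ‖P_{≤ 8R} I_{Rk} P_N u‖_{ℓ²_k B^{2σ}_{t,p,2} L_x^q L_y^2} ‖_{ℓ^{s,2}_N}`,
where `R ≪ N` means `2 ^ c * R ≤ N`. -/
def galileiTerm (η : ℝ → ℝ) (c : ℕ) (σ s p q : ℝ) (u : ℝ → L2xy m n) : ℝ≥0∞ :=
  dyadicNorm s fun j =>
    ⨆ (i : ℕ) (_ : i + c ≤ j), ((2 : ℝ≥0∞) ^ i) ^ (-(4 * σ)) *
      (∑' k : (Fin m → ℤ) × (Fin n → ℤ),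
        besovNorm η (2 * σ) p q (fun t =>
          lpLow η (8 * 2 ^ i) (galileiDyadic i k (fun r => lpProj η j (u r)) t)) ^ 2) ^ (1 / 2 : ℝ)

/-- The norm of `Z^s`, with values in `[0, ∞]`, where the maximum runs over the pairs
`(p, a)` in `T`. -/
def zNorm (η : ℝ → ℝ) (c : ℕ) (σ : ℝ) (T : Set (ℝ × ℝ)) (s : ℝ) (u : ℝ → L2xy m n) : ℝ≥0∞ :=
  ⨆ x ∈ T,
    (dyadicNorm s (fun j => mixedNorm x.1 (strichartzExponent m x.1) fun t => lpProj η j (u t)) +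
      dyadicNorm (s - 2 * x.2) (fun j =>
        besovNorm η x.2 x.1 (strichartzExponent m x.1) fun t => lpProj η j (u t)) +
      galileiTerm η c σ s x.1 (strichartzExponent m x.1) u)

/-- The set `𝒦 = {u ∈ Y^s : ‖u‖_{Y^s} ≤ 2 C₁, ‖u‖_{Z^s} ≤ 2 C₂}`. -/
def ballK (m n : ℕ) (η : ℝ → ℝ) (c : ℕ) (σ : ℝ) (T : Set (ℝ × ℝ)) (s C₁ C₂ : ℝ) :
    Set (ℝ → L2xy m n) :=
  {u | yNorm s u ≤ ENNReal.ofReal (2 * C₁) ∧ zNorm η c σ T s u ≤ ENNReal.ofReal (2 * C₂)}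

end Waveguide

end

/-!
The proof realizes `𝒦` as a closed subset of the Banach space `Y⁰` (`Y0`) of functions of finite
`Y⁰` norm, so that completeness of `Y⁰` passes to `𝒦`.

*Completeness of `Y⁰`.* The characters form an orthogonal basis of `L²(𝕋ⁿ)` (`characterBasis`), hence
Plancherel's identity holds on `ℝᵐ × 𝕋ⁿ` (`enorm_sq_eq_lintegral`) and a Fourier multiplier multiplies
the Fourier transform by its symbol (`xyFourier_multiplier`). As the cubes tile the frequency space,
`‖f‖² = ∑_z ‖P_{C_z} f‖²` (`tsum_enorm_cubeProj_sq`), which gives `‖u‖_{V²_Δ} ≤ ‖u‖_{Y⁰}`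
(`vDeltaNorm_le_yNorm`) and, with the partitions `t < ∞`, the bound `‖u(t)‖ ≤ ‖u‖_{Y⁰}` at every time
`t`. A Cauchy sequence of `Y⁰` therefore converges at every time. All `Y^s` norms are suprema of
continuous functions of finitely many values of `u`, so they are lower semicontinuous for pointwise
convergence in time (`lowerSemicontinuous_yNorm`), and the pointwise limit is the limit in `Y⁰`.

*Closedness of `𝒦`.* It remains to see that the `Z^s` norm is lower semicontinuous on `Y⁰`. This is
Fatou's lemma, which needs measurability in time. A function of finite `V²` norm is continuous outside
the countable set of jumps of its (monotone) quadratic variation, hence measurable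
(`stronglyMeasurable_of_vNorm_ne_top`), and `e^{itΔ}` is strongly continuous, so the elements of `Y⁰`
are measurable. The notion that carries the induction through the definition of `Z^s` is
`BoundedFamily`: measurable functions of time depending continuously on a parameter at every time,
with a locally uniform bound. It is stable under Fourier multipliers in space, under temporal
projectors (their kernels are Schwartz functions; dominated convergence), and under Galilean
transformations (which are strongly continuous in time). Lebesgue norms are lower semicontinuous on
`L²`, and so mixed norms are lower semicontinuous along such families
(`BoundedFamily.lowerSemicontinuous_mixedNorm`); sums and suprema preserve this.
-/

noncomputable section

namespace Waveguide

/-! ### Functions of finite `V²` norm -/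

section Variation

variable {E : Type*} [NormedAddCommGroup E]

@[simp] lemma extendTop_top (v : ℝ → E) : extendTop v ⊤ = 0 := rfl

@[simp] lemma extendTop_coe (v : ℝ → E) (t : ℝ) : extendTop v (t : WithTop ℝ) = v t := rfl

lemma extendTop_add (v w : ℝ → E) (t : WithTop ℝ) :
    extendTop (v + w) t = extendTop v t + extendTop w t := by
  induction t <;> simp

lemma extendTop_neg (v : ℝ → E) (t : WithTop ℝ) : extendTop (-v) t = -extendTop v t := by
  induction t <;> simp

lemma extendTop_comp {F : Type*} [NormedAddCommGroup F] (L : E → F) (hL : L 0 = 0) (v : ℝ → E)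
    (t : WithTop ℝ) : extendTop (fun r => L (v r)) t = L (extendTop v t) := by
  induction t <;> simp [hL]

lemma continuous_extendTop (t : WithTop ℝ) : Continuous fun v : ℝ → E => extendTop v t := by
  induction t with
  | top => simpa using continuous_const
  | coe t => simpa using continuous_apply t

lemma rpow_half_sq (a : ℝ≥0∞) : (a ^ (1 / 2 : ℝ)) ^ 2 = a := by
  rw [← ENNReal.rpow_natCast, ← ENNReal.rpow_mul]; norm_num

lemma sq_rpow_half (a : ℝ≥0∞) : (a ^ 2) ^ (1 / 2 : ℝ) = a := by
  rw [← ENNReal.rpow_natCast, ← ENNReal.rpow_mul]; norm_num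

lemma rpow_half_le_rpow_half {a b : ℝ≥0∞} (h : a ≤ b) : a ^ (1 / 2 : ℝ) ≤ b ^ (1 / 2 : ℝ) :=
  ENNReal.rpow_le_rpow h (by norm_num)

lemma rpow_sum_le_vNorm (v : ℝ → E) {K : ℕ} {t : Fin (K + 1) → WithTop ℝ} (ht : StrictMono t) :
    (∑ i : Fin K, ‖extendTop v (t i.succ) - extendTop v (t i.castSucc)‖ₑ ^ 2) ^ (1 / 2 : ℝ) ≤
      vNorm v :=
  le_iSup_of_le K (le_iSup₂_of_le t ht le_rfl)

lemma sum_le_vNorm_sq (v : ℝ → E) {K : ℕ} {t : Fin (K + 1) → WithTop ℝ} (ht : StrictMono t) :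
    ∑ i : Fin K, ‖extendTop v (t i.succ) - extendTop v (t i.castSucc)‖ₑ ^ 2 ≤ vNorm v ^ 2 := by
  rw [← rpow_half_sq (∑ i : Fin K, _)]
  gcongr
  exact rpow_sum_le_vNorm v ht

lemma vNorm_le_of_forall_sum_le {v : ℝ → E} {C : ℝ≥0∞}
    (h : ∀ (K : ℕ) (t : Fin (K + 1) → WithTop ℝ), StrictMono t →
      ∑ i : Fin K, ‖extendTop v (t i.succ) - extendTop v (t i.castSucc)‖ₑ ^ 2 ≤ C ^ 2) :
    vNorm v ≤ C := by
  refine iSup_le fun K => iSup₂_le fun t ht => ?_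
  rw [← sq_rpow_half C]
  exact rpow_half_le_rpow_half (h K t ht)

lemma enorm_le_vNorm (v : ℝ → E) (t : ℝ) : ‖v t‖ₑ ≤ vNorm v := by
  have ht : StrictMono ![(t : WithTop ℝ), ⊤] := by
    rw [Fin.strictMono_iff_lt_succ]
    simp
  have := rpow_half_le_rpow_half (sum_le_vNorm_sq v ht)
  simpa only [Fin.sum_univ_one, Fin.succ_zero_eq_one, Fin.castSucc_zero, Matrix.cons_val_one,
    Matrix.cons_val_zero, extendTop_top, extendTop_coe, zero_sub, enorm_neg, sq_rpow_half]
    using this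

@[simp] lemma vNorm_zero : vNorm (0 : ℝ → E) = 0 := by
  refine le_antisymm (vNorm_le_of_forall_sum_le fun K t _ => ?_) zero_le
  have : ∀ t, extendTop (0 : ℝ → E) t = 0 := fun t => by induction t <;> simp
  simp [this]

lemma vNorm_neg (v : ℝ → E) : vNorm (-v) = vNorm v := by
  simp only [vNorm, extendTop_neg, ← neg_sub', enorm_neg]

/-- Minkowski's inequality for finite sums of squares in `[0, ∞]`. -/
lemma sum_sq_add_le {ι : Type*} (s : Finset ι) (f g : ι → ℝ≥0∞) :
    (∑ i ∈ s, (f i + g i) ^ 2) ^ (1 / 2 : ℝ) ≤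
      (∑ i ∈ s, f i ^ 2) ^ (1 / 2 : ℝ) + (∑ i ∈ s, g i ^ 2) ^ (1 / 2 : ℝ) := by
  simpa using ENNReal.Lp_add_le s f g (p := 2) (by norm_num)

/-- Minkowski's inequality for sums of squares in `[0, ∞]`. -/
lemma tsum_sq_add_le {ι : Type*} (f g : ι → ℝ≥0∞) :
    (∑' i, (f i + g i) ^ 2) ^ (1 / 2 : ℝ) ≤
      (∑' i, f i ^ 2) ^ (1 / 2 : ℝ) + (∑' i, g i ^ 2) ^ (1 / 2 : ℝ) := by
  have h := (ENNReal.continuous_rpow_const (y := 1 / 2)).continuousAt.tendsto.comp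
    (ENNReal.summable (f := fun i => (f i + g i) ^ 2)).hasSum
  refine le_of_tendsto h (Eventually.of_forall fun s => ?_)
  refine (sum_sq_add_le s f g).trans ?_
  gcongr <;> exact ENNReal.sum_le_tsum s

lemma vNorm_add_le (v w : ℝ → E) : vNorm (v + w) ≤ vNorm v + vNorm w := by
  refine iSup_le fun K => iSup₂_le fun t ht => ?_
  calc _ ≤ (∑ i : Fin K, (‖extendTop v (t i.succ) - extendTop v (t i.castSucc)‖ₑ
            + ‖extendTop w (t i.succ) - extendTop w (t i.castSucc)‖ₑ) ^ 2) ^ (1 / 2 : ℝ) := by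
        gcongr with i
        rw [extendTop_add, extendTop_add, add_sub_add_comm]
        exact enorm_add_le _ _
    _ ≤ _ := (sum_sq_add_le _ _ _).trans <| add_le_add
        (rpow_sum_le_vNorm v ht) (rpow_sum_le_vNorm w ht)

/-- The `V²` norm is lower semicontinuous for pointwise convergence in time. -/
lemma lowerSemicontinuous_vNorm : LowerSemicontinuous (vNorm : (ℝ → E) → ℝ≥0∞) := by
  refine lowerSemicontinuous_iSup fun K => lowerSemicontinuous_iSup fun t =>
    lowerSemicontinuous_iSup fun _ => Continuous.lowerSemicontinuous ?_
  refine ENNReal.continuous_rpow_const.comp (continuous_finsetSum _ fun i _ => ?_)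
  exact (ENNReal.continuous_pow 2).comp
    ((continuous_extendTop _).sub (continuous_extendTop _)).enorm

/-- The square of the 2-variation of `v` on `(-∞, t]`: the supremum of the sums
`∑ ‖v(t_k) - v(t_{k-1})‖²` over all finite partitions whose last point is `t`. -/
def quadraticVariation (v : ℝ → E) (t : ℝ) : ℝ≥0∞ :=
  ⨆ (K : ℕ) (τ : Fin (K + 1) → ℝ) (_ : StrictMono τ ∧ τ (Fin.last K) = t),
    ∑ i : Fin K, ‖v (τ i.succ) - v (τ i.castSucc)‖ₑ ^ 2

lemma quadraticVariation_le (v : ℝ → E) (t : ℝ) : quadraticVariation v t ≤ vNorm v ^ 2 :=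
  iSup_le fun _ => iSup₂_le fun τ hτ =>
    sum_le_vNorm_sq v (t := fun i => (τ i : WithTop ℝ)) (WithTop.coe_strictMono.comp hτ.1)

/-- Appending a point `b` to the partitions that end at `a < b`. -/
lemma quadraticVariation_add_le (v : ℝ → E) {a b : ℝ} (hab : a < b) :
    quadraticVariation v a + ‖v b - v a‖ₑ ^ 2 ≤ quadraticVariation v b := by
  have : Nonempty {K : (K : ℕ) × (Fin (K + 1) → ℝ) // StrictMono K.2 ∧ K.2 (Fin.last K.1) = a} :=
    ⟨⟨0, fun _ => a⟩, Subsingleton.strictMono (α := Fin 1) _, rfl⟩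
  have key : quadraticVariation v a = ⨆ K : {K : (K : ℕ) × (Fin (K + 1) → ℝ) //
      StrictMono K.2 ∧ K.2 (Fin.last K.1) = a},
      ∑ i : Fin K.1.1, ‖v (K.1.2 i.succ) - v (K.1.2 i.castSucc)‖ₑ ^ 2 := by
    simp only [quadraticVariation, iSup_subtype, iSup_sigma]
  rw [key, ENNReal.iSup_add]
  refine iSup_le fun ⟨⟨K, τ⟩, hτ, hl⟩ => ?_
  simp only at hτ hl
  have hmono : StrictMono (Fin.snoc (α := fun _ => ℝ) τ b) := by
    rw [Fin.strictMono_iff_lt_succ]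
    intro i
    induction i using Fin.lastCases with
    | last => simpa [hl] using hab
    | cast i =>
      rw [← Fin.castSucc_succ]
      simpa only [Fin.snoc_castSucc] using hτ i.castSucc_lt_succ
  refine le_trans (le_of_eq ?_) (le_iSup_of_le (K + 1)
    (le_iSup₂_of_le (Fin.snoc (α := fun _ => ℝ) τ b) ⟨hmono, by simp⟩ le_rfl))
  rw [Fin.sum_univ_castSucc]
  simp only [← Fin.castSucc_succ, Fin.snoc_castSucc, Fin.succ_last, Fin.snoc_last, hl]

/-- A function of finite `V²` norm is continuous away from the countably many discontinuities of
the monotone function `quadraticVariation v`. -/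
lemma stronglyMeasurable_of_vNorm_ne_top {v : ℝ → E} (hv : vNorm v ≠ ∞) : StronglyMeasurable v := by
  have hfin : ∀ t, quadraticVariation v t ≠ ∞ := fun t =>
    ne_top_of_le_ne_top (ENNReal.pow_ne_top hv) (quadraticVariation_le v t)
  set Φ : ℝ → ℝ := fun t => (quadraticVariation v t).toReal with hΦ
  have hadd : ∀ a b, a < b → Φ a + ‖v b - v a‖ ^ 2 ≤ Φ b := fun a b hab => by
    have := ENNReal.toReal_mono (hfin b) (quadraticVariation_add_le v hab)
    rwa [ENNReal.toReal_add (hfin a) (by finiteness), ENNReal.toReal_pow, toReal_enorm] at this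
  have hmono : Monotone Φ := monotone_iff_forall_lt.2 fun a b hab =>
    (le_add_of_nonneg_right (sq_nonneg _)).trans (hadd a b hab)
  have habs : ∀ a b, ‖v b - v a‖ ^ 2 ≤ |Φ b - Φ a| := fun a b => by
    rcases lt_trichotomy a b with h | h | h
    · exact (le_sub_iff_add_le'.2 (hadd a b h)).trans (le_abs_self _)
    · simp [h]
    · rw [norm_sub_rev, abs_sub_comm]
      exact (le_sub_iff_add_le'.2 (hadd b a h)).trans (le_abs_self _)
  refine StronglyMeasurable.of_countable_not_continuousAt
    (hmono.countable_not_continuousAt.mono fun a => mt fun hc : ContinuousAt Φ a => ?_)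
  rw [ContinuousAt, tendsto_iff_norm_sub_tendsto_zero]
  have h0 : Tendsto (fun b => |Φ b - Φ a|) (𝓝 a) (𝓝 0) := by
    simpa using (hc.tendsto.sub_const (Φ a)).abs
  have h1 : Tendsto (fun b => ‖v b - v a‖ ^ 2) (𝓝 a) (𝓝 0) :=
    squeeze_zero (fun _ => sq_nonneg _) (fun b => habs a b) h0
  simpa using h1.sqrt

end Variation

/-! ### Fourier series on `𝕋ⁿ` -/

section Torus

open Submodule

variable {n : ℕ}

/-- The characters of `𝕋ⁿ` as continuous functions. -/
def characterC (k : Fin n → ℤ) : C(Torus n, ℂ) where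
  toFun := character k
  continuous_toFun := by unfold character; fun_prop

@[simp] lemma characterC_apply (k : Fin n → ℤ) (y : Torus n) : characterC k y = character k y := rfl

lemma character_neg (k : Fin n → ℤ) (y : Torus n) :
    character (-k) y = (starRingEnd ℂ) (character k y) := by
  simp only [character, Pi.neg_apply, fourier_neg, map_prod]

lemma character_add (k l : Fin n → ℤ) (y : Torus n) :
    character (k + l) y = character k y * character l y := by
  simp only [character, Pi.add_apply, fourier_add, ← Finset.prod_mul_distrib]

lemma norm_character (k : Fin n → ℤ) (y : Torus n) : ‖character k y‖ = 1 := by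
  simp only [character, fourier_apply, norm_prod, Circle.norm_coe, Finset.prod_const_one]

lemma character_single (y : Torus n) (i : Fin n) :
    character (Pi.single i 1) y = fourier 1 (y i) := by
  rw [character, Finset.prod_eq_single i]
  · simp
  · intro j _ hj
    simp [Pi.single_eq_of_ne hj]
  · simp

/-- The star subalgebra of `C(𝕋ⁿ, ℂ)` generated by the characters. -/
def characterSubalgebra (n : ℕ) : StarSubalgebra ℂ C(Torus n, ℂ) where
  toSubalgebra := Algebra.adjoin ℂ (range characterC)
  star_mem' := by
    change Algebra.adjoin ℂ (range characterC) ≤ star (Algebra.adjoin ℂ (range characterC))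
    refine Algebra.adjoin_le ?_
    rintro _ ⟨k, rfl⟩
    refine Algebra.subset_adjoin ⟨-k, ?_⟩
    ext1 y
    simp only [characterC_apply, character_neg, starRingEnd_apply, ContinuousMap.star_apply]

lemma characterSubalgebra_coe :
    (characterSubalgebra n).toSubalgebra.toSubmodule = span ℂ (range characterC) := by
  apply Algebra.adjoin_eq_span_of_subset
  refine .trans (fun x => Submonoid.closure_induction (fun _ => id) ⟨0, ?_⟩ ?_) subset_span
  · ext y
    simp [character]
  · rintro _ _ _ _ ⟨k, rfl⟩ ⟨l, rfl⟩
    exact ⟨k + l, by ext y; simp [character_add]⟩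

lemma characterSubalgebra_separatesPoints : (characterSubalgebra n).SeparatesPoints := by
  intro x y hxy
  obtain ⟨i, hi⟩ := Function.ne_iff.1 hxy
  refine ⟨_, ⟨characterC (Pi.single i 1), Algebra.subset_adjoin ⟨Pi.single i 1, rfl⟩, rfl⟩, ?_⟩
  change character _ x ≠ character _ y
  rw [character_single, character_single, fourier_one, fourier_one]
  exact fun h => hi (AddCircle.injective_toCircle Real.two_pi_pos.ne' (Circle.ext h))

/-- By the Stone-Weierstrass theorem, trigonometric polynomials are dense in `C(𝕋ⁿ)`. -/
lemma span_characterC_closure_eq_top :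
    (span ℂ (range (characterC (n := n)))).topologicalClosure = ⊤ := by
  rw [← characterSubalgebra_coe]
  exact congr_arg (Subalgebra.toSubmodule <| StarSubalgebra.toSubalgebra ·)
    (ContinuousMap.starSubalgebra_topologicalClosure_eq_top_of_separatesPoints _
      characterSubalgebra_separatesPoints)

/-- The characters as elements of `L²(𝕋ⁿ)`. -/
def characterL2 (k : Fin n → ℤ) : L2y n := ContinuousMap.toLp (E := ℂ) 2 volume ℂ (characterC k)

lemma toL2_of_memLp {X E : Type*} [MeasurableSpace X] [NormedAddCommGroup E] {μ : Measure X}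
    {f : X → E} (h : MemLp f 2 μ) : toL2 μ f = h.toLp f := dif_pos h

lemma coeFn_toL2 {X E : Type*} [MeasurableSpace X] [NormedAddCommGroup E] {μ : Measure X}
    {f : X → E} (h : MemLp f 2 μ) : toL2 μ f =ᵐ[μ] f := by
  rw [toL2_of_memLp h]; exact h.coeFn_toLp

lemma memLp_character (k : Fin n → ℤ) : MemLp (character k) 2 (volume : Measure (Torus n)) :=
  MemLp.of_bound (characterC k).continuous.aestronglyMeasurable 1
    (Eventually.of_forall fun y => (norm_character k y).le)

lemma toL2_character (k : Fin n → ℤ) : toL2 volume (character k) = characterL2 k := by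
  ext1
  exact (coeFn_toL2 (memLp_character k)).trans (ContinuousMap.coeFn_toLp volume (characterC k)).symm

lemma integral_fourier (j : ℤ) :
    ∫ y : AddCircle (2 * π), fourier j y = if j = 0 then ((2 * π : ℝ) : ℂ) else 0 := by
  have h := (orthonormal_iff_ite.mp <| orthonormal_fourier (T := 2 * π)) 0 j
  rw [ContinuousMap.inner_toLp] at h
  simp only [fourier_zero, map_one, mul_one] at h
  rw [AddCircle.volume_eq_smul_haarAddCircle, integral_smul_measure, h,
    ENNReal.toReal_ofReal Real.two_pi_pos.le]
  simp [eq_comm]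

lemma inner_characterL2 (k l : Fin n → ℤ) :
    inner ℂ (characterL2 k) (characterL2 l) = if k = l then (((2 * π) ^ n : ℝ) : ℂ) else 0 := by
  rw [characterL2, characterL2, ContinuousMap.inner_toLp]
  simp only [characterC_apply, ← character_neg, ← character_add]
  simp only [character, MeasureTheory.integral_fintype_prod_volume_eq_prod, integral_fourier]
  split_ifs with h
  · simp [h]
  · obtain ⟨i, hi⟩ := Function.ne_iff.mp h
    refine Finset.prod_eq_zero (Finset.mem_univ i) (if_neg ?_)
    simp only [Pi.add_apply, Pi.neg_apply]
    omega

/-- The square root of the inverse volume of `𝕋ⁿ`, which normalizes the characters. -/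
def characterScale (n : ℕ) : ℝ := (√((2 * π) ^ n))⁻¹

lemma characterScale_sq (n : ℕ) : characterScale n * characterScale n = ((2 * π) ^ n)⁻¹ := by
  rw [characterScale, ← mul_inv, Real.mul_self_sqrt (by positivity)]

lemma characterScale_pos (n : ℕ) : 0 < characterScale n := by
  unfold characterScale; positivity

lemma orthonormal_character :
    Orthonormal ℂ fun k : Fin n → ℤ => (characterScale n : ℂ) • characterL2 k := by
  rw [orthonormal_iff_ite]
  intro k l
  rw [inner_smul_left, inner_smul_right, inner_characterL2, Complex.conj_ofReal, ← mul_assoc,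
    ← Complex.ofReal_mul, characterScale_sq]
  split_ifs
  · rw [← Complex.ofReal_mul, inv_mul_cancel₀ (by positivity), Complex.ofReal_one]
  · simp

lemma span_characterL2_closure_eq_top :
    (span ℂ (range (characterL2 (n := n)))).topologicalClosure = ⊤ := by
  simpa only [map_span, ContinuousLinearMap.coe_coe, ← range_comp, Function.comp_def] using!
    (ContinuousMap.toLp_denseRange ℂ (volume : Measure (Torus n)) ℂ
      (p := 2) (by simp)).topologicalClosure_map_submodule span_characterC_closure_eq_top

/-- The orthonormal basis of `L²(𝕋ⁿ)` of the normalized characters. -/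
def characterBasis (n : ℕ) : HilbertBasis (Fin n → ℤ) ℂ (L2y n) :=
  HilbertBasis.mk orthonormal_character <| by
    rw [← span_characterL2_closure_eq_top]
    refine topologicalClosure_mono (span_le.2 ?_)
    rintro _ ⟨k, rfl⟩
    have hc : (characterScale n : ℂ) ≠ 0 := Complex.ofReal_ne_zero.2 (characterScale_pos n).ne'
    rw [← inv_smul_smul₀ hc (characterL2 k)]
    exact smul_mem _ _ (subset_span ⟨k, rfl⟩)

lemma characterBasis_apply (k : Fin n → ℤ) :
    characterBasis n k = (characterScale n : ℂ) • characterL2 k := by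
  rw [characterBasis, HilbertBasis.coe_mk]

lemma coeff_smul_character (k : Fin n → ℤ) (g : L2y n) :
    coeff k g • characterL2 k = (characterBasis n).repr g k • characterBasis n k := by
  have h : ∫ y, (starRingEnd ℂ) (character k y) * g y = inner ℂ (characterL2 k) g := by
    rw [MeasureTheory.L2.inner_def]
    refine integral_congr_ae ?_
    filter_upwards [ContinuousMap.coeFn_toLp (p := 2) (𝕜 := ℂ) volume (characterC k)] with y hy
    rw [characterL2, hy, RCLike.inner_apply, mul_comm, characterC_apply]
  rw [coeff, h, HilbertBasis.repr_apply_apply, characterBasis_apply, inner_smul_left, smul_smul,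
    ← Complex.ofReal_inv, ← characterScale_sq, Complex.conj_ofReal, Complex.ofReal_mul]
  ring_nf

lemma torusMultiplier_eq (a : (Fin n → ℤ) → ℂ) (g : L2y n) :
    torusMultiplier a g = ∑' k, (a k * (characterBasis n).repr g k) • characterBasis n k := by
  simp only [torusMultiplier, toL2_character, mul_smul, coeff_smul_character]

lemma enorm_sq_eq_tsum (g : L2y n) :
    ‖g‖ₑ ^ 2 = ∑' k, ‖(characterBasis n).repr g k‖ₑ ^ 2 := by
  have h := lp.hasSum_norm (p := 2) (by norm_num) ((characterBasis n).repr g)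
  simp only [ENNReal.toReal_ofNat, LinearIsometryEquiv.norm_map, Real.rpow_ofNat] at h
  rw [← ofReal_norm, ← ENNReal.ofReal_pow (norm_nonneg _), ← h.tsum_eq,
    ENNReal.ofReal_tsum_of_nonneg (fun _ => by positivity) h.summable]
  simp only [← ofReal_norm, ← ENNReal.ofReal_pow (norm_nonneg _)]

variable {a : (Fin n → ℤ) → ℂ} {C : ℝ}

lemma memℓp_mul_repr (ha : ∀ k, ‖a k‖ ≤ C) (g : L2y n) :
    Memℓp (fun k => a k * (characterBasis n).repr g k) 2 := by
  refine memℓp_gen ?_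
  have h := (lp.memℓp ((characterBasis n).repr g)).summable (by norm_num)
  simp only [ENNReal.toReal_ofNat, Real.rpow_ofNat] at h ⊢
  refine Summable.of_nonneg_of_le (fun _ => by positivity) (fun k => ?_) (h.mul_left (C ^ 2))
  rw [norm_mul, mul_pow]
  gcongr
  exact ha k

lemma hasSum_torusMultiplier (ha : ∀ k, ‖a k‖ ≤ C) (g : L2y n) :
    HasSum (fun k => (a k * (characterBasis n).repr g k) • characterBasis n k)
      (torusMultiplier a g) := by
  rw [torusMultiplier_eq]
  exact ((characterBasis n).hasSum_repr_symm ⟨_, memℓp_mul_repr ha g⟩).summable.hasSum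

lemma repr_torusMultiplier (ha : ∀ k, ‖a k‖ ≤ C) (g : L2y n) (k : Fin n → ℤ) :
    (characterBasis n).repr (torusMultiplier a g) k = a k * (characterBasis n).repr g k := by
  have h : torusMultiplier a g = (characterBasis n).repr.symm ⟨_, memℓp_mul_repr ha g⟩ :=
    (hasSum_torusMultiplier ha g).unique
      ((characterBasis n).hasSum_repr_symm ⟨_, memℓp_mul_repr ha g⟩)
  rw [h, LinearIsometryEquiv.apply_symm_apply]

lemma enorm_torusMultiplier_sq (ha : ∀ k, ‖a k‖ ≤ C) (g : L2y n) :
    ‖torusMultiplier a g‖ₑ ^ 2 = ∑' k, ‖a k‖ₑ ^ 2 * ‖(characterBasis n).repr g k‖ₑ ^ 2 := by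
  simp only [enorm_sq_eq_tsum, repr_torusMultiplier ha, enorm_mul, mul_pow]

lemma norm_torusMultiplier_le (ha : ∀ k, ‖a k‖ ≤ C) (g : L2y n) :
    ‖torusMultiplier a g‖ ≤ C * ‖g‖ := by
  have hC : 0 ≤ C := (norm_nonneg _).trans (ha 0)
  have h : ‖torusMultiplier a g‖ₑ ^ 2 ≤ (ENNReal.ofReal C * ‖g‖ₑ) ^ 2 := by
    rw [enorm_torusMultiplier_sq ha, mul_pow, enorm_sq_eq_tsum, ← ENNReal.tsum_mul_left]
    gcongr with k
    rw [← ofReal_norm]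
    exact ENNReal.ofReal_le_ofReal (ha k)
  have h' := (ENNReal.pow_le_pow_left_iff two_ne_zero).1 h
  rwa [← ofReal_norm, ← ofReal_norm, ← ENNReal.ofReal_mul hC,
    ENNReal.ofReal_le_ofReal_iff (by positivity)] at h'

end Torus

/-! ### Fourier multipliers -/

section Multiplier

/-- Dominated convergence in `L²`. -/
lemma tendsto_toL2 {X E ι : Type*} [MeasurableSpace X] [NormedAddCommGroup E] {μ : Measure X}
    {l : Filter ι} [l.IsCountablyGenerated] {G : ι → X → E} {g : X → E} {b : X → ℝ}
    (hG : ∀ i, AEStronglyMeasurable (G i) μ) (hg : AEStronglyMeasurable g μ) (hb : MemLp b 2 μ)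
    (hGb : ∀ i, ∀ᵐ x ∂μ, ‖G i x‖ ≤ b x) (hgb : ∀ᵐ x ∂μ, ‖g x‖ ≤ b x)
    (hlim : ∀ᵐ x ∂μ, Tendsto (fun i => G i x) l (𝓝 (g x))) :
    Tendsto (fun i => toL2 μ (G i)) l (𝓝 (toL2 μ g)) := by
  have hG2 : ∀ i, MemLp (G i) 2 μ := fun i => hb.mono' (hG i) (hGb i)
  have hg2 : MemLp g 2 μ := hb.mono' hg hgb
  simp only [toL2_of_memLp (hG2 _), toL2_of_memLp hg2]
  rw [Lp.tendsto_Lp_iff_tendsto_eLpNorm'']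
  simp only [eLpNorm_eq_lintegral_rpow_enorm_toReal (p := 2) two_ne_zero ENNReal.ofNat_ne_top,
    ENNReal.toReal_ofNat, Pi.sub_apply]
  have h0 : (0 : ℝ≥0∞) = (∫⁻ _ : X, 0 ∂μ) ^ (1 / 2 : ℝ) := by simp
  rw [h0]
  refine (ENNReal.continuous_rpow_const.tendsto _).comp (tendsto_of_seq_tendsto fun j hj => ?_)
  refine tendsto_lintegral_of_dominated_convergence' (fun x => ‖2 * b x‖ₑ ^ (2 : ℝ))
    (fun i => ((hG (j i)).sub hg).enorm.pow_const _) (fun i => ?_) ?_ ?_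
  · filter_upwards [hGb (j i), hgb] with x h1 h2
    gcongr
    rw [enorm_le_iff_norm_le]
    refine (norm_sub_le _ _).trans ((add_le_add h1 h2).trans ?_)
    rw [← two_mul]
    exact le_abs_self _
  · have := (hb.const_mul 2).2
    rw [eLpNorm_lt_top_iff_lintegral_rpow_enorm_lt_top two_ne_zero ENNReal.ofNat_ne_top] at this
    simpa using this.ne
  · filter_upwards [hlim] with x hx
    have h1 : Tendsto (fun i => ‖G (j i) x - g x‖ₑ) atTop (𝓝 0) := by
      simpa using ((hx.comp hj).sub_const (g x)).enorm
    have h2 := ((ENNReal.continuous_rpow_const (y := 2)).tendsto 0).comp h1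
    rwa [ENNReal.zero_rpow_of_pos two_pos] at h2

variable {m n : ℕ}

/-- The symbols of the Fourier multipliers: bounded by `C` and measurable in `ξ`. -/
structure IsSymbol (C : ℝ) (a : EuclideanSpace ℝ (Fin m) → (Fin n → ℤ) → ℂ) : Prop where
  measurable : ∀ k, Measurable fun ξ => a ξ k
  norm_le : ∀ ξ k, ‖a ξ k‖ ≤ C

variable {a b : EuclideanSpace ℝ (Fin m) → (Fin n → ℤ) → ℂ} {C D : ℝ}

/-- The partial Fourier transform in `x` followed by Fourier coefficients in `y`. -/
def xyFourier (f : L2xy m n) (ζ : EuclideanSpace ℝ (Fin m)) (k : Fin n → ℤ) : ℂ :=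
  (characterBasis n).repr ((𝓕 f : L2xy m n) ζ) k

lemma aestronglyMeasurable_xyFourier (f : L2xy m n) (k : Fin n → ℤ) :
    AEStronglyMeasurable (fun ζ => xyFourier f ζ k) volume := by
  simp only [xyFourier, HilbertBasis.repr_apply_apply]
  exact (continuous_const.inner continuous_id).comp_aestronglyMeasurable (Lp.aestronglyMeasurable _)

/-- Dominated convergence for Fourier multipliers on `𝕋ⁿ`. -/
lemma tendsto_torusMultiplier {ι : Type*} {l : Filter ι} {a : (Fin n → ℤ) → ℂ}
    {A : ι → (Fin n → ℤ) → ℂ} {C : ℝ} (ha : ∀ k, ‖a k‖ ≤ C) (hA : ∀ i k, ‖A i k‖ ≤ C)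
    (h : ∀ k, Tendsto (fun i => A i k) l (𝓝 (a k))) (g : L2y n) :
    Tendsto (fun i => torusMultiplier (A i) g) l (𝓝 (torusMultiplier a g)) := by
  rw [tendsto_iff_norm_sub_tendsto_zero]
  have hsq : ∀ i, ‖torusMultiplier (A i) g - torusMultiplier a g‖ ^ 2 =
      ∑' k, ‖A i k - a k‖ ^ 2 * ‖(characterBasis n).repr g k‖ ^ 2 := fun i => by
    have h := lp.hasSum_norm (p := 2) (by norm_num)
      ((characterBasis n).repr (torusMultiplier (A i) g - torusMultiplier a g))
    simp only [ENNReal.toReal_ofNat, LinearIsometryEquiv.norm_map, Real.rpow_ofNat] at h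
    rw [← h.tsum_eq]
    refine tsum_congr fun k => ?_
    rw [map_sub, lp.coeFn_sub, Pi.sub_apply, repr_torusMultiplier (hA i), repr_torusMultiplier ha,
      ← sub_mul, norm_mul, mul_pow]
  have hs := (lp.memℓp ((characterBasis n).repr g)).summable (by norm_num)
  simp only [ENNReal.toReal_ofNat, Real.rpow_ofNat] at hs
  have h0 : Tendsto (fun i => ‖torusMultiplier (A i) g - torusMultiplier a g‖ ^ 2) l (𝓝 0) := by
    simp only [hsq]
    have hz : (0 : ℝ) = ∑' _ : Fin n → ℤ, (0 : ℝ) := tsum_zero.symm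
    rw [hz]
    refine tendsto_tsum_of_dominated_convergence (hs.mul_left ((2 * C) ^ 2)) (fun k => ?_)
      (Eventually.of_forall fun i k => ?_)
    · have := ((h k).sub_const (a k)).norm.pow 2 |>.mul_const (‖(characterBasis n).repr g k‖ ^ 2)
      simpa using this
    · rw [norm_of_nonneg (by positivity)]
      gcongr
      linarith [norm_sub_le (A i k) (a k), hA i k, ha k]
  simpa using h0.sqrt

lemma aestronglyMeasurable_torusMultiplier (ha : IsSymbol C a)
    {F : EuclideanSpace ℝ (Fin m) → L2y n} (hF : AEStronglyMeasurable F volume) :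
    AEStronglyMeasurable (fun ζ => torusMultiplier (a ((2 * π) • ζ)) (F ζ)) volume := by
  refine aestronglyMeasurable_of_tendsto_ae atTop
    (f := fun (s : Finset (Fin n → ℤ)) ζ =>
      ∑ k ∈ s, (a ((2 * π) • ζ) k * (characterBasis n).repr (F ζ) k) • characterBasis n k)
    (fun s => Finset.aestronglyMeasurable_fun_sum _ fun k _ => ?_)
    (Eventually.of_forall fun ζ => hasSum_torusMultiplier (ha.norm_le _) _)
  refine AEStronglyMeasurable.smul_const (AEStronglyMeasurable.mul ?_ ?_) _
  · exact ((ha.measurable k).comp (measurable_const_smul (2 * π))).aestronglyMeasurable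
  · simp only [HilbertBasis.repr_apply_apply]
    exact (continuous_const.inner continuous_id).comp_aestronglyMeasurable hF

lemma memLp_torusMultiplier (ha : IsSymbol C a) (F : L2xy m n) :
    MemLp (fun ζ => torusMultiplier (a ((2 * π) • ζ)) (F ζ)) 2 volume :=
  (Lp.memLp F).of_le_mul (aestronglyMeasurable_torusMultiplier ha (Lp.aestronglyMeasurable F))
    (Eventually.of_forall fun _ => norm_torusMultiplier_le (ha.norm_le _) _)

lemma fourier_multiplier (a : EuclideanSpace ℝ (Fin m) → (Fin n → ℤ) → ℂ) (f : L2xy m n) :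
    (𝓕 (multiplier a f) : L2xy m n) =
      toL2 volume (fun ζ => torusMultiplier (a ((2 * π) • ζ)) ((𝓕 f : L2xy m n) ζ)) :=
  FourierTransform.fourier_fourierInv_eq _

/-- A Fourier multiplier acts on the Fourier side by multiplication with its symbol. -/
lemma xyFourier_multiplier (ha : IsSymbol C a) (f : L2xy m n) :
    ∀ᵐ ζ, ∀ k, xyFourier (multiplier a f) ζ k = a ((2 * π) • ζ) k * xyFourier f ζ k := by
  filter_upwards [coeFn_toL2 (memLp_torusMultiplier ha (𝓕 f : L2xy m n))] with ζ hζ k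
  rw [xyFourier, fourier_multiplier, hζ, repr_torusMultiplier (ha.norm_le _), xyFourier]

lemma xyFourier_add (f g : L2xy m n) :
    ∀ᵐ ζ, ∀ k, xyFourier (f + g) ζ k = xyFourier f ζ k + xyFourier g ζ k := by
  filter_upwards [Lp.coeFn_add (𝓕 f : L2xy m n) (𝓕 g)] with ζ hζ k
  rw [xyFourier, FourierTransform.fourier_add, hζ, Pi.add_apply, map_add]
  rfl

lemma xyFourier_smul (c : ℂ) (f : L2xy m n) :
    ∀ᵐ ζ, ∀ k, xyFourier (c • f) ζ k = c * xyFourier f ζ k := by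
  filter_upwards [Lp.coeFn_smul c (𝓕 f : L2xy m n)] with ζ hζ k
  rw [xyFourier, FourierTransform.fourier_smul, hζ, Pi.smul_apply, map_smul]
  rfl

lemma ext_xyFourier {f g : L2xy m n} (h : ∀ᵐ ζ, ∀ k, xyFourier f ζ k = xyFourier g ζ k) : f = g := by
  have : (𝓕 f : L2xy m n) = 𝓕 g := by
    ext1
    filter_upwards [h] with ζ hζ
    exact (characterBasis n).repr.injective (lp.ext (funext hζ))
  exact (Lp.fourierTransformₗᵢ (EuclideanSpace ℝ (Fin m)) (L2y n)).injective this

/-- The Plancherel identity. -/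
lemma enorm_sq_eq_lintegral (f : L2xy m n) :
    ‖f‖ₑ ^ 2 = ∫⁻ ζ, ∑' k, ‖xyFourier f ζ k‖ₑ ^ 2 := by
  have h : ‖f‖ₑ = ‖(𝓕 f : L2xy m n)‖ₑ := by
    rw [← ofReal_norm, ← ofReal_norm, Lp.norm_fourier_eq]
  rw [h, Lp.enorm_def,
    eLpNorm_eq_lintegral_rpow_enorm_toReal (p := 2) two_ne_zero ENNReal.ofNat_ne_top]
  simp only [ENNReal.toReal_ofNat, rpow_half_sq, ENNReal.rpow_ofNat, xyFourier, enorm_sq_eq_tsum]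

lemma enorm_multiplier_sq (ha : IsSymbol C a) (f : L2xy m n) :
    ‖multiplier a f‖ₑ ^ 2 =
      ∫⁻ ζ, ∑' k, ‖a ((2 * π) • ζ) k‖ₑ ^ 2 * ‖xyFourier f ζ k‖ₑ ^ 2 := by
  rw [enorm_sq_eq_lintegral]
  refine lintegral_congr_ae ?_
  filter_upwards [xyFourier_multiplier ha f] with ζ hζ
  simp only [hζ, enorm_mul, mul_pow]

lemma norm_multiplier_le (ha : IsSymbol C a) (f : L2xy m n) : ‖multiplier a f‖ ≤ C * ‖f‖ := by
  rw [← Lp.norm_fourier_eq (multiplier a f), fourier_multiplier,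
    toL2_of_memLp (memLp_torusMultiplier ha _), ← Lp.norm_fourier_eq f]
  refine Lp.norm_le_mul_norm_of_ae_le_mul ?_
  filter_upwards [(memLp_torusMultiplier ha (𝓕 f : L2xy m n)).coeFn_toLp] with ζ hζ
  rw [hζ]
  exact norm_torusMultiplier_le (ha.norm_le _) _

/-- A Fourier multiplier as a bounded operator on `L²`. -/
def multiplierCLM (ha : IsSymbol C a) : L2xy m n →L[ℂ] L2xy m n :=
  LinearMap.mkContinuous
    { toFun := multiplier a
      map_add' := fun f g => ext_xyFourier <| by
        filter_upwards [xyFourier_multiplier ha (f + g), xyFourier_multiplier ha f,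
          xyFourier_multiplier ha g, xyFourier_add f g,
          xyFourier_add (multiplier a f) (multiplier a g)] with ζ h1 h2 h3 h4 h5 k
        rw [h1, h4, h5, h2, h3, mul_add]
      map_smul' := fun c f => ext_xyFourier <| by
        filter_upwards [xyFourier_multiplier ha (c • f), xyFourier_multiplier ha f,
          xyFourier_smul c f, xyFourier_smul c (multiplier a f)] with ζ h1 h2 h3 h4 k
        rw [h1, h3, RingHom.id_apply, h4, h2, mul_left_comm] }
    C (norm_multiplier_le ha)

lemma multiplier_multiplier_comm (ha : IsSymbol C a) (hb : IsSymbol D b) (f : L2xy m n) :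
    multiplier a (multiplier b f) = multiplier b (multiplier a f) := by
  refine ext_xyFourier ?_
  filter_upwards [xyFourier_multiplier ha f, xyFourier_multiplier hb f,
    xyFourier_multiplier ha (multiplier b f), xyFourier_multiplier hb (multiplier a f)]
    with ζ h1 h2 h3 h4 k
  rw [h3, h4, h1, h2, mul_left_comm]

/-! ### The Schrödinger group and the cube projectors -/

lemma norm_schrodinger_symbol (t : ℝ) (ξ : EuclideanSpace ℝ (Fin m)) (k : Fin n → ℤ) :
    ‖Complex.exp (-(Complex.I * (t * (‖ξ‖ ^ 2 + sqNorm k) : ℝ)))‖ = 1 := by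
  rw [← mul_neg, ← Complex.ofReal_neg, Complex.norm_exp_I_mul_ofReal]

lemma isSymbol_schrodinger (t : ℝ) :
    IsSymbol 1 fun (ξ : EuclideanSpace ℝ (Fin m)) (k : Fin n → ℤ) =>
      Complex.exp (-(Complex.I * (t * (‖ξ‖ ^ 2 + sqNorm k) : ℝ))) where
  measurable k := by fun_prop
  norm_le ξ k := (norm_schrodinger_symbol t ξ k).le

lemma schrodinger_add (t : ℝ) (f g : L2xy m n) :
    schrodinger t (f + g) = schrodinger t f + schrodinger t g :=
  (multiplierCLM (isSymbol_schrodinger t)).map_add f g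

lemma schrodinger_neg (t : ℝ) (f : L2xy m n) : schrodinger t (-f) = -schrodinger t f :=
  (multiplierCLM (isSymbol_schrodinger t)).map_neg f

lemma schrodinger_sub (t : ℝ) (f g : L2xy m n) :
    schrodinger t (f - g) = schrodinger t f - schrodinger t g :=
  (multiplierCLM (isSymbol_schrodinger t)).map_sub f g

lemma continuous_schrodinger (t : ℝ) : Continuous (schrodinger t : L2xy m n → L2xy m n) :=
  (multiplierCLM (isSymbol_schrodinger t)).continuous

lemma enorm_schrodinger (t : ℝ) (f : L2xy m n) : ‖schrodinger t f‖ₑ = ‖f‖ₑ := by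
  refine (ENNReal.pow_right_strictMono two_ne_zero).injective ?_
  beta_reduce
  rw [schrodinger, enorm_multiplier_sq (isSymbol_schrodinger t), enorm_sq_eq_lintegral]
  simp only [← ofReal_norm (Complex.exp _), norm_schrodinger_symbol, ENNReal.ofReal_one, one_pow,
    one_mul]

lemma schrodinger_schrodinger_neg (t : ℝ) (f : L2xy m n) :
    schrodinger t (schrodinger (-t) f) = f := by
  refine ext_xyFourier ?_
  filter_upwards [xyFourier_multiplier (isSymbol_schrodinger (-t)) f,
    xyFourier_multiplier (isSymbol_schrodinger t) (schrodinger (-t) f)] with ζ h1 h2 k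
  rw [schrodinger, h2, schrodinger, h1, ← mul_assoc, ← Complex.exp_add]
  simp

/-- The Schrödinger group is strongly continuous. -/
lemma continuous_schrodinger_apply (f : L2xy m n) : Continuous fun t => schrodinger t f := by
  refine continuous_iff_continuousAt.2 fun t => ?_
  refine ((Lp.fourierTransformₗᵢ (EuclideanSpace ℝ (Fin m)) (L2y n)).symm.continuous.tendsto
    _).comp ?_
  refine tendsto_toL2 (b := fun ζ => ‖(𝓕 f : L2xy m n) ζ‖)
    (fun r => (memLp_torusMultiplier (isSymbol_schrodinger r) _).1)
    (memLp_torusMultiplier (isSymbol_schrodinger t) _).1 (Lp.memLp _).norm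
    (fun r => Eventually.of_forall fun ζ => ?_) (Eventually.of_forall fun ζ => ?_)
    (Eventually.of_forall fun ζ => ?_)
  · simpa using norm_torusMultiplier_le ((isSymbol_schrodinger r).norm_le _) _
  · simpa using norm_torusMultiplier_le ((isSymbol_schrodinger t).norm_le _) _
  · refine tendsto_torusMultiplier ((isSymbol_schrodinger t).norm_le _)
      (fun r => (isSymbol_schrodinger r).norm_le _) (fun k => ?_) _
    refine Continuous.tendsto (f := fun r : ℝ => Complex.exp (-(Complex.I *
      (r * (‖(2 * π) • ζ‖ ^ 2 + sqNorm k) : ℝ)))) ?_ t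
    fun_prop

lemma continuous_schrodinger_prod :
    Continuous fun p : ℝ × L2xy m n => schrodinger p.1 p.2 :=
  continuous_prod_of_continuous_lipschitzWith' _ 1
    (fun t => LipschitzWith.of_edist_le fun f g => by
      rw [edist_eq_enorm_sub, edist_eq_enorm_sub, ← schrodinger_sub, enorm_schrodinger])
    continuous_schrodinger_apply

open Classical in
/-- The characteristic function of the cube `z + (-1/2, 1/2]^d`. -/
def cubeSymbol (z : (Fin m → ℤ) × (Fin n → ℤ)) (ξ : EuclideanSpace ℝ (Fin m)) (k : Fin n → ℤ) :
    ℂ :=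
  if (∀ i, ξ i - z.1 i ∈ Ioc (-1 / 2 : ℝ) (1 / 2)) ∧
    (∀ j, (k j : ℝ) - z.2 j ∈ Ioc (-1 / 2 : ℝ) (1 / 2)) then 1 else 0

lemma isSymbol_cube (z : (Fin m → ℤ) × (Fin n → ℤ)) : IsSymbol 1 (cubeSymbol z) where
  measurable k := by
    have h : ∀ i, MeasurableSet {ξ : EuclideanSpace ℝ (Fin m) |
        ξ i - z.1 i ∈ Ioc (-1 / 2 : ℝ) (1 / 2)} := fun i => by
      have : Measurable fun ξ : EuclideanSpace ℝ (Fin m) => ξ i - z.1 i := by fun_prop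
      exact this measurableSet_Ioc
    have hset : {ξ : EuclideanSpace ℝ (Fin m) | ∀ i, ξ i - z.1 i ∈ Ioc (-1 / 2 : ℝ) (1 / 2)} =
        ⋂ i, {ξ | ξ i - (z.1 i : ℝ) ∈ Ioc (-1 / 2 : ℝ) (1 / 2)} := by
      ext
      simp
    have hall := MeasurableSet.iInter h
    rw [← hset] at hall
    exact Measurable.ite (hall.inter (MeasurableSet.const _)) measurable_const measurable_const
  norm_le ξ k := by unfold cubeSymbol; split_ifs <;> simp

lemma continuous_cubeProj (z : (Fin m → ℤ) × (Fin n → ℤ)) :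
    Continuous (cubeProj z : L2xy m n → L2xy m n) :=
  (multiplierCLM (isSymbol_cube z)).continuous

lemma cubeProj_add (z : (Fin m → ℤ) × (Fin n → ℤ)) (f g : L2xy m n) :
    cubeProj z (f + g) = cubeProj z f + cubeProj z g :=
  (multiplierCLM (isSymbol_cube z)).map_add f g

lemma cubeProj_neg (z : (Fin m → ℤ) × (Fin n → ℤ)) (f : L2xy m n) :
    cubeProj z (-f) = -cubeProj z f :=
  (multiplierCLM (isSymbol_cube z)).map_neg f

lemma cubeProj_zero (z : (Fin m → ℤ) × (Fin n → ℤ)) : cubeProj z (0 : L2xy m n) = 0 :=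
  (multiplierCLM (isSymbol_cube z)).map_zero

lemma cubeProj_sub (z : (Fin m → ℤ) × (Fin n → ℤ)) (f g : L2xy m n) :
    cubeProj z (f - g) = cubeProj z f - cubeProj z g :=
  (multiplierCLM (isSymbol_cube z)).map_sub f g

lemma schrodinger_cubeProj (t : ℝ) (z : (Fin m → ℤ) × (Fin n → ℤ)) (f : L2xy m n) :
    schrodinger t (cubeProj z f) = cubeProj z (schrodinger t f) :=
  multiplier_multiplier_comm (isSymbol_schrodinger t) (isSymbol_cube z) f

/-- Half-open unit intervals centred at the integers tile the line. -/
lemma sub_intCast_mem_Ioc_iff (x : ℝ) (j : ℤ) :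
    x - j ∈ Ioc (-1 / 2 : ℝ) (1 / 2) ↔ j = ⌈x - 1 / 2⌉ := by
  rw [eq_comm, Int.ceil_eq_iff, mem_Ioc]
  constructor <;> rintro ⟨h1, h2⟩ <;> constructor <;> linarith

/-- The cubes tile the frequency space. -/
lemma tsum_enorm_cubeSymbol_sq (ξ : EuclideanSpace ℝ (Fin m)) (k : Fin n → ℤ) :
    ∑' z : (Fin m → ℤ) × (Fin n → ℤ), ‖cubeSymbol z ξ k‖ₑ ^ 2 = 1 := by
  simp only [cubeSymbol, sub_intCast_mem_Ioc_iff]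
  rw [tsum_eq_single (fun i => ⌈ξ i - 1 / 2⌉, fun j => ⌈(k j : ℝ) - 1 / 2⌉)]
  · simp
  · rintro ⟨z, w⟩ hz
    rw [if_neg]
    · simp
    · exact fun h => hz (Prod.ext (funext h.1) (funext h.2))

/-- Since the cubes tile the frequency space, the cube projectors decompose `L²` orthogonally. -/
lemma tsum_enorm_cubeProj_sq (f : L2xy m n) : ∑' z, ‖cubeProj z f‖ₑ ^ 2 = ‖f‖ₑ ^ 2 := by
  have hmeas : ∀ z : (Fin m → ℤ) × (Fin n → ℤ), AEMeasurable (fun ζ =>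
      ∑' k, ‖cubeSymbol z ((2 * π) • ζ) k‖ₑ ^ 2 * ‖xyFourier f ζ k‖ₑ ^ 2) volume := fun z => by
    refine AEMeasurable.tsum fun k => AEMeasurable.fun_mul ?_ ?_
    · exact ((((isSymbol_cube z).measurable k).comp
        (measurable_const_smul (2 * π))).enorm.pow_const 2).aemeasurable
    · exact (aestronglyMeasurable_xyFourier f k).enorm.pow_const 2
  have hcube : ∀ z : (Fin m → ℤ) × (Fin n → ℤ), ‖cubeProj z f‖ₑ ^ 2 =
      ∫⁻ ζ, ∑' k, ‖cubeSymbol z ((2 * π) • ζ) k‖ₑ ^ 2 * ‖xyFourier f ζ k‖ₑ ^ 2 := fun z =>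
    enorm_multiplier_sq (isSymbol_cube z) f
  simp only [hcube]
  rw [enorm_sq_eq_lintegral, ← lintegral_tsum hmeas]
  refine lintegral_congr fun ζ => ?_
  rw [ENNReal.tsum_comm]
  simp only [ENNReal.tsum_mul_right, tsum_enorm_cubeSymbol_sq, one_mul]

end Multiplier

/-! ### The Banach space `Y⁰` -/

section YSpace

variable {m n : ℕ}

lemma schrodinger_zero (t : ℝ) : schrodinger t (0 : L2xy m n) = 0 :=
  (multiplierCLM (isSymbol_schrodinger t)).map_zero

lemma vDeltaNorm_zero : vDeltaNorm (0 : ℝ → L2xy m n) = 0 := by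
  simp only [vDeltaNorm, Pi.zero_apply, schrodinger_zero]
  exact vNorm_zero

lemma vDeltaNorm_add_le (u v : ℝ → L2xy m n) :
    vDeltaNorm (u + v) ≤ vDeltaNorm u + vDeltaNorm v := by
  simp only [vDeltaNorm, Pi.add_apply, schrodinger_add]
  exact vNorm_add_le _ _

lemma vDeltaNorm_neg (u : ℝ → L2xy m n) : vDeltaNorm (-u) = vDeltaNorm u := by
  simp only [vDeltaNorm, Pi.neg_apply, schrodinger_neg]
  exact vNorm_neg _

lemma lowerSemicontinuous_vDeltaNorm :
    LowerSemicontinuous (vDeltaNorm : (ℝ → L2xy m n) → ℝ≥0∞) :=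
  lowerSemicontinuous_vNorm.comp <| continuous_pi fun t =>
    (continuous_schrodinger (-t)).comp (continuous_apply t)

lemma yNorm_zero_left (u : ℝ → L2xy m n) :
    yNorm 0 u = (∑' z, vDeltaNorm (fun t => cubeProj z (u t)) ^ 2) ^ (1 / 2 : ℝ) := by
  simp [yNorm]

lemma yNorm_zero_le {s : ℝ} (hs : 0 ≤ s) (u : ℝ → L2xy m n) : yNorm 0 u ≤ yNorm s u := by
  rw [yNorm_zero_left, yNorm]
  gcongr with z
  refine le_mul_of_one_le_left zero_le ?_
  rw [← ENNReal.ofReal_one]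
  refine ENNReal.ofReal_le_ofReal (Real.one_le_rpow ?_ hs)
  have : ∀ {N : ℕ} (k : Fin N → ℤ), 0 ≤ sqNorm k := fun k =>
    Finset.sum_nonneg fun _ _ => sq_nonneg _
  linarith [this z.1, this z.2]

lemma lowerSemicontinuous_yNorm (s : ℝ) :
    LowerSemicontinuous (yNorm s : (ℝ → L2xy m n) → ℝ≥0∞) := by
  refine ENNReal.continuous_rpow_const.comp_lowerSemicontinuous
    (lowerSemicontinuous_tsum fun z => ?_) (ENNReal.monotone_rpow_of_nonneg (by norm_num))
  have h : LowerSemicontinuous fun u : ℝ → L2xy m n => vDeltaNorm fun t => cubeProj z (u t) :=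
    lowerSemicontinuous_vDeltaNorm.comp <| continuous_pi fun t =>
      (continuous_cubeProj z).comp (continuous_apply t)
  refine (ENNReal.continuous_const_mul ENNReal.ofReal_ne_top).comp_lowerSemicontinuous
    ((ENNReal.continuous_pow 2).comp_lowerSemicontinuous h fun a b hab => ?_)
    fun a b hab => ?_
  · exact pow_le_pow_left' hab 2
  · exact mul_le_mul_right hab _

@[simp] lemma yNorm_zero : yNorm 0 (0 : ℝ → L2xy m n) = 0 := by
  have h := vDeltaNorm_zero (m := m) (n := n)
  rw [yNorm_zero_left]
  simp only [Pi.zero_apply, cubeProj_zero]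
  have : (fun _ => 0 : ℝ → L2xy m n) = 0 := rfl
  simp [this, h]

lemma yNorm_neg (u : ℝ → L2xy m n) : yNorm 0 (-u) = yNorm 0 u := by
  have : ∀ z, (fun t => cubeProj z ((-u) t)) = -fun t => cubeProj z (u t) := fun z =>
    funext fun t => cubeProj_neg z (u t)
  simp only [yNorm_zero_left, this, vDeltaNorm_neg]

lemma yNorm_add_le (u v : ℝ → L2xy m n) : yNorm 0 (u + v) ≤ yNorm 0 u + yNorm 0 v := by
  simp only [yNorm_zero_left]
  refine le_trans ?_ (tsum_sq_add_le _ _)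
  gcongr with z
  have : (fun t => cubeProj z ((u + v) t)) =
      (fun t => cubeProj z (u t)) + fun t => cubeProj z (v t) :=
    funext fun t => cubeProj_add z (u t) (v t)
  rw [this]
  exact vDeltaNorm_add_le _ _

/-- By orthogonality of the cube projectors, `Y⁰` embeds into `V²_Δ`. -/
lemma vDeltaNorm_le_yNorm (u : ℝ → L2xy m n) : vDeltaNorm u ≤ yNorm 0 u := by
  refine vNorm_le_of_forall_sum_le fun K t ht => ?_
  rw [yNorm_zero_left, rpow_half_sq]
  simp only [← tsum_enorm_cubeProj_sq (_ - _)]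
  rw [← Summable.tsum_finsetSum fun _ _ => ENNReal.summable]
  refine ENNReal.tsum_le_tsum fun z => ?_
  have h : ∀ τ, cubeProj z (extendTop (fun t => schrodinger (-t) (u t)) τ) =
      extendTop (fun t => schrodinger (-t) (cubeProj z (u t))) τ := fun τ => by
    rw [← extendTop_comp (cubeProj z) (cubeProj_zero z)]
    simp only [schrodinger_cubeProj]
  simp only [cubeProj_sub, h]
  exact sum_le_vNorm_sq _ ht

lemma enorm_le_yNorm (u : ℝ → L2xy m n) (t : ℝ) : ‖u t‖ₑ ≤ yNorm 0 u := by
  rw [← enorm_schrodinger (-t)]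
  exact (enorm_le_vNorm (fun t => schrodinger (-t) (u t)) t).trans (vDeltaNorm_le_yNorm u)

/-- Elements of `Y⁰` are measurable in time: `u(t) = e^{itΔ} v(t)` with `v` of finite `V²` norm. -/
lemma stronglyMeasurable_of_yNorm_ne_top {u : ℝ → L2xy m n} (hu : yNorm 0 u ≠ ∞) :
    StronglyMeasurable u := by
  have hv : StronglyMeasurable fun t => schrodinger (-t) (u t) :=
    stronglyMeasurable_of_vNorm_ne_top (ne_top_of_le_ne_top hu (vDeltaNorm_le_yNorm u))
  have h := continuous_schrodinger_prod.comp_stronglyMeasurable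
    (stronglyMeasurable_id.prodMk hv)
  simpa only [id, schrodinger_schrodinger_neg] using h

variable (m n) in
/-- The functions of finite `Y⁰` norm. -/
def y0Subgroup : AddSubgroup (ℝ → L2xy m n) where
  carrier := {u | yNorm 0 u < ∞}
  zero_mem' := by simp
  add_mem' {u v} hu hv := (yNorm_add_le u v).trans_lt (ENNReal.add_lt_top.2 ⟨hu, hv⟩)
  neg_mem' {u} hu := by simpa [yNorm_neg] using hu

variable (m n) in
/-- The space `Y⁰`; a type of its own, since as a subtype it would carry the topology of pointwise
convergence. -/
def Y0 : Type := y0Subgroup m n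

instance : AddCommGroup (Y0 m n) := inferInstanceAs (AddCommGroup (y0Subgroup m n))

/-- The function of time underlying an element of `Y⁰`. -/
def Y0.toFun (u : Y0 m n) : ℝ → L2xy m n := Subtype.val u

instance : CoeFun (Y0 m n) fun _ => ℝ → L2xy m n := ⟨Y0.toFun⟩

/-- A function of finite `Y⁰` norm as an element of `Y⁰`. -/
def Y0.mk (u : ℝ → L2xy m n) (hu : yNorm 0 u < ∞) : Y0 m n := Subtype.mk u hu

lemma Y0.coe_sub (u v : Y0 m n) : ⇑(u - v) = u - v := rfl

lemma yNorm_ne_top (u : Y0 m n) : yNorm 0 u ≠ ∞ := (Subtype.property u).ne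

instance : NormedAddCommGroup (Y0 m n) :=
  AddGroupNorm.toNormedAddCommGroup
    { toFun := fun u => (yNorm 0 u).toReal
      map_zero' := by
        change (yNorm 0 (0 : ℝ → L2xy m n)).toReal = 0
        simp
      add_le' := fun u v => by
        rw [← ENNReal.toReal_add (yNorm_ne_top u) (yNorm_ne_top v)]
        exact ENNReal.toReal_mono (ENNReal.add_ne_top.2 ⟨yNorm_ne_top u, yNorm_ne_top v⟩)
          (yNorm_add_le _ _)
      neg' := fun u => congrArg ENNReal.toReal (yNorm_neg u)
      eq_zero_of_map_eq_zero' := fun u hu => by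
        rw [ENNReal.toReal_eq_zero_iff, or_iff_left (yNorm_ne_top u)] at hu
        refine Subtype.ext (funext fun t => ?_)
        have h := enorm_le_yNorm u t
        rw [hu, nonpos_iff_eq_zero, enorm_eq_zero] at h
        exact h }

lemma Y0.norm_def (u : Y0 m n) : ‖u‖ = (yNorm 0 u).toReal := rfl

lemma Y0.ofReal_dist (u v : Y0 m n) :
    ENNReal.ofReal (dist u v) = yNorm 0 (u - v : ℝ → L2xy m n) := by
  rw [dist_eq_norm, Y0.norm_def, ENNReal.ofReal_toReal (yNorm_ne_top _), Y0.coe_sub]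

lemma Y0.norm_apply_le (u : Y0 m n) (t : ℝ) : ‖u t‖ ≤ ‖u‖ := by
  rw [← toReal_enorm]
  exact ENNReal.toReal_mono (yNorm_ne_top u) (enorm_le_yNorm _ t)

lemma Y0.lipschitzWith_apply (t : ℝ) : LipschitzWith 1 fun u : Y0 m n => u t :=
  LipschitzWith.of_dist_le_mul fun u v => by
    rw [dist_eq_norm, dist_eq_norm, NNReal.coe_one, one_mul]
    exact Y0.norm_apply_le (u - v) t

lemma Y0.continuous_coe : Continuous fun u : Y0 m n => (u : ℝ → L2xy m n) :=
  continuous_pi fun t => (Y0.lipschitzWith_apply t).continuous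

/-- A Cauchy sequence in `Y⁰` converges at each time, and the pointwise limit is the limit in `Y⁰`
because the norm is lower semicontinuous for pointwise convergence. -/
instance : CompleteSpace (Y0 m n) := by
  refine Metric.complete_of_cauchySeq_tendsto fun w hw => ?_
  have hlim : ∀ t, ∃ f, Tendsto (fun j => w j t) atTop (𝓝 f) := fun t =>
    cauchySeq_tendsto_of_complete ((Y0.lipschitzWith_apply t).uniformContinuous.comp_cauchySeq hw)
  choose v hv using hlim
  have hclose : ∀ ε > 0, ∃ N, ∀ j ≥ N, yNorm 0 (⇑(w j) - v) ≤ ENNReal.ofReal ε := by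
    intro ε hε
    obtain ⟨N, hN⟩ := Metric.cauchySeq_iff.1 hw ε hε
    refine ⟨N, fun j hj => ?_⟩
    have hclosed : IsClosed {f : ℝ → L2xy m n | yNorm 0 f ≤ ENNReal.ofReal ε} :=
      (lowerSemicontinuous_yNorm 0).isClosed_preimage _
    change ⇑(w j) - v ∈ {f : ℝ → L2xy m n | yNorm 0 f ≤ ENNReal.ofReal ε}
    refine hclosed.mem_of_tendsto (f := fun l => ⇑(w j) - ⇑(w l)) (b := atTop)
      (tendsto_const_nhds.sub (tendsto_pi_nhds.2 hv)) ?_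
    filter_upwards [eventually_ge_atTop N] with l hl
    rw [← Y0.ofReal_dist]
    exact ENNReal.ofReal_le_ofReal (hN j hj l hl).le
  have hmem : v ∈ y0Subgroup m n := by
    obtain ⟨N, hN⟩ := hclose 1 one_pos
    have h1 : ⇑(w N) - v ∈ y0Subgroup m n := (hN N le_rfl).trans_lt ENNReal.ofReal_lt_top
    have h2 := (y0Subgroup m n).sub_mem (Subtype.property (w N)) h1
    rwa [← Y0.toFun, sub_sub_cancel] at h2
  refine ⟨Y0.mk v hmem, Metric.tendsto_atTop.2 fun ε hε => ?_⟩
  obtain ⟨N, hN⟩ := hclose (ε / 2) (half_pos hε)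
  refine ⟨N, fun j hj => lt_of_le_of_lt ?_ (half_lt_self hε)⟩
  rw [← ENNReal.ofReal_le_ofReal_iff (half_pos hε).le, Y0.ofReal_dist]
  exact hN j hj

end YSpace

/-! ### Galilean transformations -/

section Galilei

lemma toL2_congr_ae {X E : Type*} [MeasurableSpace X] [NormedAddCommGroup E] {μ : Measure X}
    {f g : X → E} (h : f =ᵐ[μ] g) : toL2 μ f = toL2 μ g := by
  by_cases hf : MemLp f 2 μ
  · have hg : MemLp g 2 μ := (memLp_congr_ae h).1 hf
    rw [toL2_of_memLp hf, toL2_of_memLp hg]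
    exact MemLp.toLp_congr hf hg h
  · have hg : ¬ MemLp g 2 μ := fun hg => hf ((memLp_congr_ae h).2 hg)
    rw [toL2, toL2, dif_neg hf, dif_neg hg]

section Phase

variable {X E F : Type*} [MeasurableSpace X] {μ : Measure X}
  [NormedAddCommGroup E] [NormedSpace ℂ E] [NormedAddCommGroup F] [NormedSpace ℂ F]
  {φ : X → ℂ}

lemma memLp_phase (hφ : AEStronglyMeasurable φ μ) (hφ1 : ∀ x, ‖φ x‖ = 1) (T : E →L[ℂ] F)
    (h : Lp E 2 μ) : MemLp (fun x => φ x • T (h x)) 2 μ :=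
  (Lp.memLp h).of_le_mul (c := ‖T‖)
    (hφ.smul (T.continuous.comp_aestronglyMeasurable (Lp.aestronglyMeasurable h)))
    (Eventually.of_forall fun x => by rw [norm_smul, hφ1, one_mul]; exact T.le_opNorm _)

/-- The operator `h ↦ φ(x) T(h(x))` on `L²`, for a unimodular function `φ`. -/
def phaseCLM (hφ : AEStronglyMeasurable φ μ) (hφ1 : ∀ x, ‖φ x‖ = 1) (T : E →L[ℂ] F) :
    Lp E 2 μ →L[ℂ] Lp F 2 μ :=
  LinearMap.mkContinuous
    { toFun := fun h => toL2 μ fun x => φ x • T (h x)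
      map_add' := fun f g => by
        ext1
        filter_upwards [coeFn_toL2 (memLp_phase hφ hφ1 T (f + g)),
          coeFn_toL2 (memLp_phase hφ hφ1 T f), coeFn_toL2 (memLp_phase hφ hφ1 T g),
          Lp.coeFn_add f g, Lp.coeFn_add (toL2 μ fun x => φ x • T (f x))
            (toL2 μ fun x => φ x • T (g x))] with x h1 h2 h3 h4 h5
        rw [h1, h5, Pi.add_apply, h2, h3, h4, Pi.add_apply, map_add, smul_add]
      map_smul' := fun c f => by
        ext1
        filter_upwards [coeFn_toL2 (memLp_phase hφ hφ1 T (c • f)),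
          coeFn_toL2 (memLp_phase hφ hφ1 T f), Lp.coeFn_smul c f,
          Lp.coeFn_smul c (toL2 μ fun x => φ x • T (f x))] with x h1 h2 h3 h4
        rw [h1, RingHom.id_apply, h4, Pi.smul_apply, h2, h3, Pi.smul_apply, map_smul, smul_comm] }
    ‖T‖ fun h => by
      change ‖toL2 μ fun x => φ x • T (h x)‖ ≤ _
      rw [toL2_of_memLp (memLp_phase hφ hφ1 T h)]
      refine Lp.norm_le_mul_norm_of_ae_le_mul ?_
      filter_upwards [(memLp_phase hφ hφ1 T h).coeFn_toLp] with x hx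
      rw [hx, norm_smul, hφ1, one_mul]
      exact T.le_opNorm _

lemma norm_phaseCLM_le (hφ : AEStronglyMeasurable φ μ) (hφ1 : ∀ x, ‖φ x‖ = 1) (T : E →L[ℂ] F) :
    ‖phaseCLM hφ hφ1 T‖ ≤ ‖T‖ :=
  LinearMap.mkContinuous_norm_le _ (norm_nonneg _) _

end Phase

/-- A strongly continuous family of contractions is jointly continuous. -/
lemma continuous_clm_uncurry {E F : Type*} [NormedAddCommGroup E] [NormedSpace ℂ E]
    [NormedAddCommGroup F] [NormedSpace ℂ F] {A : ℝ → E →L[ℂ] F} (hA : ∀ t, ‖A t‖ ≤ 1)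
    (h : ∀ f, Continuous fun t => A t f) : Continuous fun p : ℝ × E => A p.1 p.2 :=
  continuous_prod_of_continuous_lipschitzWith' _ 1
    (fun t => (A t).lipschitz.weaken (by exact_mod_cast hA t)) h

variable {m n : ℕ}

lemma measurePreserving_torusShift (k : Fin n → ℤ) (b : ℝ) :
    MeasurePreserving (fun y : Torus n => y - fun j => ((b * k j : ℝ) : AddCircle (2 * π)))
      volume volume :=
  measurePreserving_sub_right volume _

lemma aestronglyMeasurable_character (k : Fin n → ℤ) :
    AEStronglyMeasurable (character k) (volume : Measure (Torus n)) :=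
  (characterC k).continuous.aestronglyMeasurable

/-- `torusGalilei` as a bounded operator. -/
def torusGalileiCLM (k : Fin n → ℤ) (b : ℝ) : L2y n →L[ℂ] L2y n :=
  (phaseCLM (aestronglyMeasurable_character k) (norm_character k) (.id ℂ ℂ)).comp
    (Lp.compMeasurePreservingₗᵢ ℂ _ (measurePreserving_torusShift k b)).toContinuousLinearMap

lemma torusGalileiCLM_apply (k : Fin n → ℤ) (b : ℝ) (g : L2y n) :
    torusGalileiCLM k b g = torusGalilei k b g := by
  refine toL2_congr_ae ?_
  filter_upwards [Lp.coeFn_compMeasurePreserving g (measurePreserving_torusShift k b)] with y hy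
  exact congrArg (character k y * ·) hy

lemma norm_torusGalileiCLM_le (k : Fin n → ℤ) (b : ℝ) : ‖torusGalileiCLM k b‖ ≤ 1 := by
  refine (ContinuousLinearMap.opNorm_comp_le _ _).trans ?_
  refine mul_le_one₀ ((norm_phaseCLM_le _ _ _).trans ContinuousLinearMap.norm_id_le)
    (norm_nonneg _) (LinearIsometry.norm_toContinuousLinearMap_le _)

lemma continuous_torusGalileiCLM (k : Fin n → ℤ) (g : L2y n) :
    Continuous fun b => torusGalileiCLM k b g := by
  let γ : C(ℝ, C(Torus n, Torus n)) := ContinuousMap.curry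
    ⟨fun p : ℝ × Torus n => p.2 - fun j => ((p.1 * k j : ℝ) : AddCircle (2 * π)), by
      refine continuous_snd.sub (continuous_pi fun j => ?_)
      exact (AddCircle.continuous_mk' _).comp (by fun_prop)⟩
  have h : Continuous fun b => Lp.compMeasurePreserving _ (measurePreserving_torusShift k b) g :=
    (continuous_const (y := g)).compMeasurePreservingLp γ.continuous
      (fun b => measurePreserving_torusShift k b) ENNReal.ofNat_ne_top
  exact (phaseCLM (aestronglyMeasurable_character k) (norm_character k) (.id ℂ ℂ)).continuous.comp h

/-- The phase `e^{i x·ξ - i t |ξ|²}` of the Galilean transformation, without its part in `y`. -/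
def galileiPhase (ξx : EuclideanSpace ℝ (Fin m)) (ξy : Fin n → ℤ) (t : ℝ)
    (x : EuclideanSpace ℝ (Fin m)) : ℂ :=
  Complex.exp (Complex.I * (inner ℝ x ξx - t * (‖ξx‖ ^ 2 + sqNorm ξy) : ℝ))

lemma norm_galileiPhase (ξx : EuclideanSpace ℝ (Fin m)) (ξy : Fin n → ℤ) (t : ℝ)
    (x : EuclideanSpace ℝ (Fin m)) : ‖galileiPhase ξx ξy t x‖ = 1 :=
  Complex.norm_exp_I_mul_ofReal _

lemma aestronglyMeasurable_galileiPhase (ξx : EuclideanSpace ℝ (Fin m)) (ξy : Fin n → ℤ) (t : ℝ) :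
    AEStronglyMeasurable (galileiPhase ξx ξy t) volume :=
  Continuous.aestronglyMeasurable (by unfold galileiPhase; fun_prop)

lemma measurePreserving_shift (ξx : EuclideanSpace ℝ (Fin m)) (t : ℝ) :
    MeasurePreserving (fun x : EuclideanSpace ℝ (Fin m) => x - (2 * t) • ξx) volume volume :=
  measurePreserving_sub_right volume _

/-- The action of the Galilean transformation on `L²(ℝᵐ × 𝕋ⁿ)` at time `t`. -/
def galileiCLM (ξx : EuclideanSpace ℝ (Fin m)) (ξy : Fin n → ℤ) (t : ℝ) :
    L2xy m n →L[ℂ] L2xy m n :=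
  (phaseCLM (aestronglyMeasurable_galileiPhase ξx ξy t) (norm_galileiPhase ξx ξy t)
      (torusGalileiCLM ξy (2 * t))).comp
    (Lp.compMeasurePreservingₗᵢ ℂ _ (measurePreserving_shift ξx t)).toContinuousLinearMap

lemma galileiCLM_apply (ξx : EuclideanSpace ℝ (Fin m)) (ξy : Fin n → ℤ) (u : ℝ → L2xy m n)
    (t : ℝ) : galileiCLM ξx ξy t (u t) = galilei ξx ξy u t := by
  refine toL2_congr_ae ?_
  filter_upwards [Lp.coeFn_compMeasurePreserving (u t) (measurePreserving_shift ξx t)] with x hx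
  rw [torusGalileiCLM_apply]
  exact congrArg (fun g => galileiPhase ξx ξy t x • torusGalilei ξy (2 * t) g) hx

lemma norm_galileiCLM_le (ξx : EuclideanSpace ℝ (Fin m)) (ξy : Fin n → ℤ) (t : ℝ) :
    ‖galileiCLM ξx ξy t‖ ≤ 1 := by
  refine (ContinuousLinearMap.opNorm_comp_le _ _).trans ?_
  refine mul_le_one₀ ((norm_phaseCLM_le _ _ _).trans (norm_torusGalileiCLM_le _ _))
    (norm_nonneg _) (LinearIsometry.norm_toContinuousLinearMap_le _)

/-- Translations in `x` act strongly continuously. -/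
lemma continuous_shift (ξx : EuclideanSpace ℝ (Fin m)) (f : L2xy m n) :
    Continuous fun t => Lp.compMeasurePreserving _ (measurePreserving_shift ξx t) f := by
  let γ : C(ℝ, C(EuclideanSpace ℝ (Fin m), EuclideanSpace ℝ (Fin m))) := ContinuousMap.curry
    ⟨fun p : ℝ × EuclideanSpace ℝ (Fin m) => p.2 - (2 * p.1) • ξx, by fun_prop⟩
  exact (continuous_const (y := f)).compMeasurePreservingLp γ.continuous
    (fun t => measurePreserving_shift ξx t) ENNReal.ofNat_ne_top

/-- The factor of `galileiCLM` that is not a translation in `x`. -/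
def galileiPhaseCLM (ξx : EuclideanSpace ℝ (Fin m)) (ξy : Fin n → ℤ) (t : ℝ) :
    L2xy m n →L[ℂ] L2xy m n :=
  phaseCLM (aestronglyMeasurable_galileiPhase ξx ξy t) (norm_galileiPhase ξx ξy t)
    (torusGalileiCLM ξy (2 * t))

lemma continuous_galileiPhaseCLM_apply (ξx : EuclideanSpace ℝ (Fin m)) (ξy : Fin n → ℤ)
    (f : L2xy m n) : Continuous fun t => galileiPhaseCLM ξx ξy t f := by
  have hbound : ∀ t x, ‖galileiPhase ξx ξy t x • torusGalileiCLM ξy (2 * t) (f x)‖ ≤ ‖f x‖ :=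
    fun t x => by
      rw [norm_smul, norm_galileiPhase, one_mul]
      simpa using (torusGalileiCLM ξy (2 * t)).le_of_opNorm_le (norm_torusGalileiCLM_le _ _) (f x)
  refine continuous_iff_continuousAt.2 fun t => ?_
  refine tendsto_toL2 (b := fun x => ‖f x‖)
    (fun r => (memLp_phase (aestronglyMeasurable_galileiPhase ξx ξy r)
      (norm_galileiPhase ξx ξy r) _ f).1)
    (memLp_phase (aestronglyMeasurable_galileiPhase ξx ξy t)
      (norm_galileiPhase ξx ξy t) _ f).1 (Lp.memLp f).norm
    (fun r => Eventually.of_forall (hbound r)) (Eventually.of_forall (hbound t))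
    (Eventually.of_forall fun x => ?_)
  have h1 : Continuous fun r => galileiPhase ξx ξy r x := by unfold galileiPhase; fun_prop
  have h2 := (continuous_torusGalileiCLM ξy (f x)).comp (continuous_const_mul (2 : ℝ))
  exact (h1.smul h2).tendsto t

/-- Galilean transformations act strongly continuously in time: translations do, and the phases
and the translations in `y` are handled by dominated convergence. -/
lemma continuous_galileiCLM (ξx : EuclideanSpace ℝ (Fin m)) (ξy : Fin n → ℤ) :
    Continuous fun p : ℝ × L2xy m n => galileiCLM ξx ξy p.1 p.2 := by
  have hphase : Continuous fun p : ℝ × L2xy m n => galileiPhaseCLM ξx ξy p.1 p.2 :=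
    continuous_clm_uncurry (A := galileiPhaseCLM ξx ξy)
      (fun t => (norm_phaseCLM_le _ _ _).trans (norm_torusGalileiCLM_le _ _))
      (continuous_galileiPhaseCLM_apply ξx ξy)
  have hf : ∀ f : L2xy m n, Continuous fun t => galileiCLM ξx ξy t f := fun f => by
    have h := hphase.comp (continuous_id.prodMk (continuous_shift ξx f))
    exact h
  exact continuous_clm_uncurry (A := galileiCLM ξx ξy) (norm_galileiCLM_le ξx ξy) hf

end Galilei

/-! ### Lower semicontinuity of mixed Lebesgue norms -/

section Lsc

variable {m n : ℕ} {A : Type*} [TopologicalSpace A]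

/-- Fatou's lemma: the integral of a family of nonnegative functions that is lower semicontinuous
in the parameter is lower semicontinuous. -/
lemma lowerSemicontinuous_lintegral [FirstCountableTopology A] {X : Type*} [MeasurableSpace X]
    {μ : Measure X} {F : A → X → ℝ≥0∞} (hmeas : ∀ a, AEMeasurable (F a) μ)
    (hF : ∀ x, LowerSemicontinuous fun a => F a x) :
    LowerSemicontinuous fun a => ∫⁻ x, F a x ∂μ := by
  refine lowerSemicontinuous_iff_le_liminf.2 fun a => ?_
  calc ∫⁻ x, F a x ∂μ ≤ ∫⁻ x, liminf (fun b => F b x) (𝓝 a) ∂μ :=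
        lintegral_mono fun x => (hF x).le_liminf a
    _ ≤ _ := lintegral_liminf_le' hmeas

lemma _root_.LowerSemicontinuous.ennreal_rpow {f : A → ℝ≥0∞} (hf : LowerSemicontinuous f) {r : ℝ}
    (hr : 0 ≤ r) : LowerSemicontinuous fun a => f a ^ r :=
  ENNReal.continuous_rpow_const.comp_lowerSemicontinuous hf (ENNReal.monotone_rpow_of_nonneg hr)

lemma _root_.LowerSemicontinuous.ennreal_sq {f : A → ℝ≥0∞} (hf : LowerSemicontinuous f) :
    LowerSemicontinuous fun a => f a ^ 2 :=
  (ENNReal.continuous_pow 2).comp_lowerSemicontinuous hf fun _ _ h => pow_le_pow_left' h 2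

lemma _root_.LowerSemicontinuous.ennreal_const_mul {f : A → ℝ≥0∞} (hf : LowerSemicontinuous f)
    {c : ℝ≥0∞} (hc : c ≠ ∞) : LowerSemicontinuous fun a => c * f a :=
  (ENNReal.continuous_const_mul hc).comp_lowerSemicontinuous hf fun _ _ h => mul_le_mul_right h c

/-- By Fatou's lemma along almost everywhere convergent subsequences, every Lebesgue norm is lower
semicontinuous on `L²`. -/
lemma lowerSemicontinuous_eLpNorm {X E : Type*} [MeasurableSpace X] {μ : Measure X}
    [NormedAddCommGroup E] (q : ℝ≥0∞) :
    LowerSemicontinuous fun f : Lp E 2 μ => eLpNorm f q μ := by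
  refine lowerSemicontinuous_iff_isClosed_preimage.2 fun y => IsSeqClosed.isClosed ?_
  intro f g hf hfg
  obtain ⟨ns, -, hns⟩ := (tendstoInMeasure_of_tendsto_Lp hfg).exists_seq_tendsto_ae
  exact Lp.eLpNorm_le_of_ae_tendsto (Eventually.of_forall fun i => hf (ns i))
    (fun i => Lp.aestronglyMeasurable _) hns

/-- A family of functions of time that are measurable and bounded, locally uniformly in the
parameter, and that depends continuously on the parameter at each time. -/
structure BoundedFamily (w : A → ℝ → L2xy m n) : Prop where
  aestronglyMeasurable : ∀ a, AEStronglyMeasurable (w a) volume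
  exists_bound : ∃ B : A → ℝ, Continuous B ∧ ∀ a t, ‖w a t‖ ≤ B a
  continuous : ∀ t, Continuous fun a => w a t

variable {w v : A → ℝ → L2xy m n}

lemma BoundedFamily.lowerSemicontinuous_mixedNorm [FirstCountableTopology A]
    (hw : BoundedFamily w) (p q : ℝ) : LowerSemicontinuous fun a => mixedNorm p q (w a) := by
  -- For `p ≤ 0` the exponent `ENNReal.ofReal p` is `0`, and the norm vanishes identically.
  rcases le_or_gt p 0 with hp | hp
  · simp only [mixedNorm, ENNReal.ofReal_of_nonpos hp, eLpNorm_exponent_zero]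
    exact lowerSemicontinuous_const
  have hp0 : ENNReal.ofReal p ≠ 0 := by simpa using hp
  simp only [mixedNorm, eLpNorm_eq_lintegral_rpow_enorm_toReal hp0 ENNReal.ofReal_ne_top,
    enorm_eq_self]
  refine LowerSemicontinuous.ennreal_rpow (lowerSemicontinuous_lintegral (fun a => ?_) fun t => ?_)
    (by positivity)
  · let _ : MeasurableSpace (L2xy m n) := borel _
    have : BorelSpace (L2xy m n) := ⟨rfl⟩
    exact (((lowerSemicontinuous_eLpNorm (ENNReal.ofReal q)).measurable).comp_aemeasurable
      (hw.aestronglyMeasurable a).aemeasurable).pow_const _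
  · exact ((lowerSemicontinuous_eLpNorm _).comp (hw.continuous t)).ennreal_rpow (by positivity)

lemma BoundedFamily.sub (hw : BoundedFamily w) (hv : BoundedFamily v) :
    BoundedFamily fun a => w a - v a where
  aestronglyMeasurable a := (hw.aestronglyMeasurable a).sub (hv.aestronglyMeasurable a)
  exists_bound := by
    obtain ⟨B, hB, hwB⟩ := hw.exists_bound
    obtain ⟨D, hD, hvD⟩ := hv.exists_bound
    exact ⟨fun a => B a + D a, hB.add hD, fun a t =>
      (norm_sub_le _ _).trans (add_le_add (hwB a t) (hvD a t))⟩
  continuous t := (hw.continuous t).sub (hv.continuous t)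

lemma BoundedFamily.clm (hw : BoundedFamily w) (L : L2xy m n →L[ℂ] L2xy m n) :
    BoundedFamily fun a t => L (w a t) where
  aestronglyMeasurable a := L.continuous.comp_aestronglyMeasurable (hw.aestronglyMeasurable a)
  exists_bound := by
    obtain ⟨B, hB, hwB⟩ := hw.exists_bound
    exact ⟨fun a => ‖L‖ * B a, hB.const_mul _, fun a t => L.le_opNorm_of_le (hwB a t)⟩
  continuous t := L.continuous.comp (hw.continuous t)

lemma BoundedFamily.galilei (hw : BoundedFamily w) (ξx : EuclideanSpace ℝ (Fin m))
    (ξy : Fin n → ℤ) : BoundedFamily fun a => galilei ξx ξy (w a) where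
  aestronglyMeasurable a := by
    have h := (continuous_galileiCLM ξx ξy).comp_aestronglyMeasurable
      (aestronglyMeasurable_id.prodMk (hw.aestronglyMeasurable a))
    exact h.congr (Eventually.of_forall fun t => galileiCLM_apply ξx ξy (w a) t)
  exists_bound := by
    obtain ⟨B, hB, hwB⟩ := hw.exists_bound
    refine ⟨B, hB, fun a t => ?_⟩
    rw [← galileiCLM_apply]
    refine ((galileiCLM ξx ξy t).le_of_opNorm_le (norm_galileiCLM_le ξx ξy t) _).trans ?_
    rw [one_mul]
    exact hwB a t
  continuous t := by
    simp only [← galileiCLM_apply]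
    exact (galileiCLM ξx ξy t).continuous.comp (hw.continuous t)

/-! ### Littlewood-Paley projectors -/

variable {η : ℝ → ℝ}

/-- The kernel of `P^t_{≤ N}` is a rescaled inverse Fourier transform of a Schwartz function. -/
lemma exists_schwartz_timeKernel (hη : IsBump η) {N : ℝ} (hN : 0 < N) :
    ∃ g : SchwartzMap ℝ ℂ, ∀ t, timeKernel η N t = ((2 * π : ℝ) : ℂ)⁻¹ * g (t / (2 * π)) := by
  have hsupp : HasCompactSupport fun τ : ℝ => (η (τ / N) : ℂ) := by
    refine HasCompactSupport.intro (isCompact_Icc (a := -(2 * N)) (b := 2 * N)) fun τ hτ => ?_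
    rw [hη.eq_zero _ ?_, Complex.ofReal_zero]
    rw [abs_div, abs_of_pos hN, le_div_iff₀ hN]
    contrapose! hτ
    exact abs_le.1 hτ.le
  have hsmooth : ContDiff ℝ (⊤ : ℕ∞) fun τ : ℝ => (η (τ / N) : ℂ) :=
    Complex.ofRealCLM.contDiff.comp (hη.smooth.comp (contDiff_id.div_const N))
  refine ⟨𝓕⁻ (hsupp.toSchwartzMap hsmooth), fun t => ?_⟩
  rw [SchwartzMap.fourierInv_coe, Real.fourierInv_eq', timeKernel]
  congr 1
  refine integral_congr_ae (Eventually.of_forall fun τ => ?_)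
  simp only [HasCompactSupport.toSchwartzMap_toFun, RCLike.inner_apply, conj_trivial, smul_eq_mul]
  rw [mul_comm]
  congr 2
  have : 2 * π * (t / (2 * π) * τ) = t * τ := by field_simp
  rw [this, mul_comm]

lemma continuous_timeKernel (hη : IsBump η) {N : ℝ} (hN : 0 < N) : Continuous (timeKernel η N) := by
  obtain ⟨g, hg⟩ := exists_schwartz_timeKernel hη hN
  rw [funext hg]
  exact continuous_const.mul (g.continuous.comp (continuous_id.div_const _))

lemma integrable_timeKernel (hη : IsBump η) {N : ℝ} (hN : 0 < N) :
    Integrable (timeKernel η N) := by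
  obtain ⟨g, hg⟩ := exists_schwartz_timeKernel hη hN
  rw [funext hg]
  exact (g.integrable.comp_div Real.two_pi_pos.ne').const_mul _

lemma BoundedFamily.timeLow [FirstCountableTopology A] (hw : BoundedFamily w) (hη : IsBump η)
    {N : ℝ} (hN : 0 < N) : BoundedFamily fun a => timeLow η N (w a) where
  aestronglyMeasurable a := by
    refine AEStronglyMeasurable.integral_prod_right'
      (f := fun z : ℝ × ℝ => timeKernel η N (z.1 - z.2) • w a z.2) ?_
    exact ((continuous_timeKernel hη hN).comp
      (continuous_fst.sub continuous_snd)).aestronglyMeasurable.smul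
        (hw.aestronglyMeasurable a).comp_snd
  exists_bound := by
    obtain ⟨B, hB, hwB⟩ := hw.exists_bound
    refine ⟨fun a => (∫ r, ‖timeKernel η N r‖) * B a, hB.const_mul _, fun a t => ?_⟩
    beta_reduce
    rw [← integral_sub_left_eq_self (fun r => ‖timeKernel η N r‖) volume t, ← integral_mul_const]
    refine norm_integral_le_of_norm_le
      (((integrable_timeKernel hη hN).comp_sub_left t).norm.mul_const _)
      (Eventually.of_forall fun r => ?_)
    rw [norm_smul]
    exact mul_le_mul_of_nonneg_left (hwB a r) (norm_nonneg _)
  continuous t := by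
    obtain ⟨B, hB, hwB⟩ := hw.exists_bound
    refine continuous_iff_continuousAt.2 fun a => ?_
    refine continuousAt_of_dominated (bound := fun r => ‖timeKernel η N (t - r)‖ * (B a + 1))
      (Eventually.of_forall fun b => ?_) ?_
      (((integrable_timeKernel hη hN).comp_sub_left t).norm.mul_const _)
      (Eventually.of_forall fun r => ?_)
    · exact ((continuous_timeKernel hη hN).comp
        (continuous_const.sub continuous_id)).aestronglyMeasurable.smul (hw.aestronglyMeasurable b)
    · filter_upwards [hB.continuousAt.eventually_lt_const (lt_add_one (B a))] with b hb
      refine Eventually.of_forall fun r => ?_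
      rw [norm_smul]
      exact mul_le_mul_of_nonneg_left ((hwB b r).trans hb.le) (norm_nonneg _)
    · have hr := hw.continuous r
      have h : Continuous fun b => timeKernel η N (t - r) • w b r := by fun_prop
      exact h.continuousAt

lemma BoundedFamily.timeProj [FirstCountableTopology A] (hw : BoundedFamily w) (hη : IsBump η)
    (j : ℕ) : BoundedFamily fun a => timeProj η j (w a) := by
  cases j with
  | zero => exact hw.timeLow hη one_pos
  | succ j => exact (hw.timeLow hη (by positivity)).sub (hw.timeLow hη (by positivity))

lemma isSymbol_low (hη : IsBump η) (N : ℝ) :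
    IsSymbol 1 fun (ξ : EuclideanSpace ℝ (Fin m)) (k : Fin n → ℤ) =>
      (((∏ i, η (ξ i / N)) * ∏ j, η ((k j : ℝ) / N) : ℝ) : ℂ) where
  measurable k := by
    have := hη.smooth.continuous
    exact Continuous.measurable (by fun_prop)
  norm_le ξ k := by
    have h0 : ∀ t, 0 ≤ η t := fun t => (hη.mem_Icc t).1
    have h1 : ∀ t, η t ≤ 1 := fun t => (hη.mem_Icc t).2
    rw [Complex.norm_real, Real.norm_of_nonneg (mul_nonneg
      (Finset.prod_nonneg fun _ _ => h0 _) (Finset.prod_nonneg fun _ _ => h0 _))]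
    exact mul_le_one₀ (Finset.prod_le_one (fun _ _ => h0 _) fun _ _ => h1 _)
      (Finset.prod_nonneg fun _ _ => h0 _) (Finset.prod_le_one (fun _ _ => h0 _) fun _ _ => h1 _)

lemma BoundedFamily.lpLow (hw : BoundedFamily w) (hη : IsBump η) (N : ℝ) :
    BoundedFamily fun a t => lpLow η N (w a t) :=
  hw.clm (multiplierCLM (isSymbol_low hη N))

lemma BoundedFamily.lpProj (hw : BoundedFamily w) (hη : IsBump η) (j : ℕ) :
    BoundedFamily fun a t => lpProj η j (w a t) := by
  cases j with
  | zero => exact hw.lpLow hη 1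
  | succ j => exact (hw.lpLow hη _).sub (hw.lpLow hη _)

/-! ### Lower semicontinuity of the `Z^s` norm -/

lemma lowerSemicontinuous_dyadicNorm (s : ℝ) {F : ℕ → A → ℝ≥0∞}
    (hF : ∀ j, LowerSemicontinuous (F j)) :
    LowerSemicontinuous fun a => dyadicNorm s fun j => F j a := by
  refine LowerSemicontinuous.ennreal_rpow (lowerSemicontinuous_tsum fun j =>
    ((hF j).ennreal_const_mul ?_).ennreal_sq) (by norm_num)
  exact ENNReal.rpow_ne_top_of_ne_zero (by simp) (by finiteness)

variable [FirstCountableTopology A]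

lemma BoundedFamily.lowerSemicontinuous_besovNorm (hw : BoundedFamily w) (hη : IsBump η)
    (a p q : ℝ) : LowerSemicontinuous fun b => besovNorm η a p q (w b) :=
  (lowerSemicontinuous_dyadicNorm a fun j =>
    (hw.timeProj hη j).lowerSemicontinuous_mixedNorm p q).add
      ((hw.timeProj hη 0).lowerSemicontinuous_mixedNorm p q)

lemma BoundedFamily.lowerSemicontinuous_galileiTerm (hw : BoundedFamily w) (hη : IsBump η)
    (c : ℕ) (σ s p q : ℝ) : LowerSemicontinuous fun a => galileiTerm η c σ s p q (w a) := by
  refine lowerSemicontinuous_dyadicNorm s fun j => lowerSemicontinuous_biSup fun i _ => ?_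
  refine LowerSemicontinuous.ennreal_const_mul ?_
    (ENNReal.rpow_ne_top_of_ne_zero (by simp) (by finiteness))
  refine LowerSemicontinuous.ennreal_rpow (lowerSemicontinuous_tsum fun k =>
    LowerSemicontinuous.ennreal_sq ?_) (by norm_num)
  exact (((hw.lpProj hη j).galilei _ _).lpLow hη _).lowerSemicontinuous_besovNorm hη _ p q

/-- All the terms of the `Z^s` norm are suprema and sums of mixed norms of bounded families. -/
lemma BoundedFamily.lowerSemicontinuous_zNorm (hw : BoundedFamily w) (hη : IsBump η) (c : ℕ)
    (σ : ℝ) (T : Set (ℝ × ℝ)) (s : ℝ) : LowerSemicontinuous fun a => zNorm η c σ T s (w a) := by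
  refine lowerSemicontinuous_biSup fun x _ => LowerSemicontinuous.add (LowerSemicontinuous.add
    (lowerSemicontinuous_dyadicNorm _ fun j => ?_) (lowerSemicontinuous_dyadicNorm _ fun j => ?_))
    (hw.lowerSemicontinuous_galileiTerm hη c σ s _ _)
  · exact (hw.lpProj hη j).lowerSemicontinuous_mixedNorm _ _
  · exact (hw.lpProj hη j).lowerSemicontinuous_besovNorm hη _ _ _

lemma Y0.boundedFamily : BoundedFamily fun u : Y0 m n => (u : ℝ → L2xy m n) where
  aestronglyMeasurable u :=
    (stronglyMeasurable_of_yNorm_ne_top (yNorm_ne_top u)).aestronglyMeasurable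
  exists_bound := ⟨fun u => ‖u‖, continuous_norm, Y0.norm_apply_le⟩
  continuous t := (Y0.lipschitzWith_apply t).continuous

/-! ### Completeness of `𝒦` -/

/-- The part of `Y⁰` that corresponds to `𝒦`. -/
def y0Ball (m n : ℕ) (η : ℝ → ℝ) (c : ℕ) (σ : ℝ) (T : Set (ℝ × ℝ)) (s C₁ C₂ : ℝ) :
    Set (Y0 m n) :=
  {u | ⇑u ∈ ballK m n η c σ T s C₁ C₂}

lemma isClosed_y0Ball (hη : IsBump η) (c : ℕ) (σ : ℝ) (T : Set (ℝ × ℝ)) (s C₁ C₂ : ℝ) :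
    IsClosed (y0Ball m n η c σ T s C₁ C₂) :=
  (((lowerSemicontinuous_yNorm s).comp Y0.continuous_coe).isClosed_preimage _).inter
    ((Y0.boundedFamily.lowerSemicontinuous_zNorm hη c σ T s).isClosed_preimage _)

/-- The identification of `𝒦` with a subset of `Y⁰`. -/
def ballKEquiv (m n : ℕ) (η : ℝ → ℝ) (c : ℕ) (σ : ℝ) (T : Set (ℝ × ℝ)) {s : ℝ} (hs : 0 ≤ s)
    (C₁ C₂ : ℝ) : ballK m n η c σ T s C₁ C₂ ≃ y0Ball m n η c σ T s C₁ C₂ where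
  toFun u := ⟨Y0.mk u.1 <| (yNorm_zero_le hs u.1).trans_lt
    (u.2.1.trans_lt ENNReal.ofReal_lt_top), u.2⟩
  invFun u := ⟨u.1, u.2⟩
  left_inv _ := rfl
  right_inv _ := rfl

end Lsc

end Waveguide

end

theorem lemma7p1 (m n : ℕ) (hm : 1 ≤ m) (hn : 1 ≤ n)
    (η : ℝ → ℝ) (hη : Waveguide.IsBump η) (c : ℕ)
    (σ σ₁ : ℝ) (hσ : 0 < σ) (hσσ₁ : σ < σ₁) (hσ₁ : σ₁ < 1 / 4)
    (T : Set (ℝ × ℝ)) (hT : T ⊆ Waveguide.zParams m σ σ₁)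
    (s : ℝ) (hs : 0 ≤ s) (C₁ C₂ : ℝ) (hC₁ : 0 < C₁) (hC₂ : 0 < C₂) :
    ∃ M : MetricSpace (Waveguide.ballK m n η c σ T s C₁ C₂),
      (∀ u v : Waveguide.ballK m n η c σ T s C₁ C₂,
        ENNReal.ofReal (M.dist u v) = Waveguide.yNorm 0 (u.1 - v.1)) ∧
      @CompleteSpace (Waveguide.ballK m n η c σ T s C₁ C₂)
        M.toPseudoMetricSpace.toUniformSpace := by
  let e := Waveguide.ballKEquiv m n η c σ T hs C₁ C₂
  let M : MetricSpace (Waveguide.ballK m n η c σ T s C₁ C₂) :=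
    MetricSpace.induced e e.injective inferInstance
  refine ⟨M, fun u v => Waveguide.Y0.ofReal_dist (e u).1 (e v).1, ?_⟩
  have : CompleteSpace (Waveguide.y0Ball m n η c σ T s C₁ C₂) :=
    (Waveguide.isClosed_y0Ball hη c σ T s C₁ C₂).completeSpace_coe
  have he : Isometry e := Isometry.of_dist_eq fun _ _ => rfl
  exact (IsometryEquiv.mk e he).completeSpace
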